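/- **Proposition 3.1.** Conventions. For a probability law $F$ on $[0,\infty)$ and $\theta>0$, $M_\theta(F)=\int_0^\infty x\,P_\theta(\mathrm dx)$, where $P_\theta$ is a Dirichlet process with total mass $\theta$ and prior distribution $F$, i.e. a random probability measure such that for every finite measurable partition $(C_1,\dots,C_k)$ of $[0,\infty)$ the vector $(P_\theta(C_1),\dots,P_\theta(C_k))$ is Dirichlet with parameters $(\theta F(C_1),\dots,\theta F(C_k))$. We also write $F(t)$ for the cumulative distribution function, and $$\psi_F(\lambda)=\int_0^\infty\log(1+\lambda x)\,F(\mathrm dx),\qquad \Phi_F(t)=\int_0^\infty \log|t-x|\,\mathbf 1(t\ne x)\,F(\mathrm dx).$$ Let $0<\sigma\le 1$, let $X\ge 0$ be a random variable with law $F_X$ and $\mathbb E[\log(1+X)]<\infty$, and let $Y_\sigma$ be a Bernoulli variable with success probability $\sigma$, independent of $X$. For $c>0$ put $A_c=cX/(cX+1)$. Let $F_{A_c}$, $F_{XY_\sigma}$ and $F_{A_cY_\sigma}$ be the laws of $A_c$, $XY_\sigma$ and $A_cY_\sigma$. Assume that $XY_\sigma$ has no atom of mass one. Let $\beta_{\sigma,1-\sigma}$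 be a beta$(\sigma,1-\sigma)$ variable ($\beta_{1,0}:=1$), independent of the mean functional that it multiplies. All the Dirichlet means below are almost surely finite, and the following hold. (i) For every $c>0$, the random variables $M_1(F_{A_cY_\sigma})$ and $\beta_{\sigma,1-\sigma}M_\sigma(F_{A_c})$ have the same law, which is concentrated on $(0,1)$ and has there the density (with respect to Lebesgue measure) $$\xi_{F_{A_cY_\sigma}}(y)=\frac{e^{\sigma\psi_{F_X}(c)}\,y^{\sigma-1}}{\pi c^{\sigma}(1-y)^{\sigma}}\,\sin\!\left[\pi F_{XY_\sigma}\!\left(\frac{y}{c(1-y)}\right)\right]e^{-\sigma\Phi_{F_X}\left(\frac{y}{c(1-y)}\right)},\qquad 0<y<1.$$ (ii) Conversely, the random variables $M_1(F_{XY_\sigma})$ and $\beta_{\sigma,1-\sigma}M_\sigma(F_X)$ have the same law, which is concentrated on $(0,\infty)$ and has there the density $$\xi_{F_{XY_\sigma}}(x)=\frac{e^{-\sigma\psi_{F_X}(1)}\,x^{\sigma-1}}{\pi(1+x)^{\sigma}}\,\sin\!\left[\pi F_{A_1Y_\sigma}\!\left(\frac{x}{1+x}\right)\right]e^{-\sigma\Phi_{F_{A_1}}\left(\frac{x}{1+x}\right)},\qquad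 x>0.$$ -/

import Mathlib

open MeasureTheory ProbabilityTheory

noncomputable section

/-- The gamma`(a, 1)` law for `a ≥ 0`, with the usual convention that gamma`(0, 1)` is the unit
mass at `0`. -/
def unitGammaLaw (a : ℝ) : Measure ℝ :=
  if a = 0 then Measure.dirac 0 else gammaMeasure a 1

/-- The beta`(a, b)` law for `a > 0`, `b ≥ 0`, with the convention `β_{a,0} := 1`. -/
def betaLaw (a b : ℝ) : Measure ℝ :=
  if b = 0 then Measure.dirac 1 else betaMeasure a b

/-- The `k`-variate Dirichlet law with parameters `a 0, …, a (k - 1) ≥ 0` (not all zero): the law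
of `(G i / ∑ j, G j)_i` for independent gamma`(a i, 1)` variables `G i`. -/
def dirichletLaw {k : ℕ} (a : Fin k → ℝ) : Measure (Fin k → ℝ) :=
  (Measure.pi fun i => unitGammaLaw (a i)).map fun g i => g i / ∑ j, g j

/-- `P` is, under the probability `μ`, a Dirichlet process with total mass `θ` and prior
distribution `F`: a random probability measure such that for each finite measurable partition
`(C 0, …, C (k - 1))`, the vector `(P (C 0), …, P (C (k - 1)))` is Dirichlet distributed with
parameters `(θ F (C 0), …, θ F (C (k - 1)))`. -/
structure IsDirichletProcess {Ω : Type*} [MeasurableSpace Ω] (θ : ℝ) (F : Measure ℝ)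
    (P : Ω → Measure ℝ) (μ : Measure Ω) : Prop where
  measurable : Measurable P
  isProbabilityMeasure : ∀ ω, IsProbabilityMeasure (P ω)
  hasLaw_partition : ∀ (k : ℕ) (C : Fin k → Set ℝ), (∀ i, MeasurableSet (C i)) →
    Pairwise (fun i j => Disjoint (C i) (C j)) → (⋃ i, C i) = Set.univ →
    HasLaw (fun ω i => (P ω).real (C i)) (dirichletLaw fun i => θ * F.real (C i)) μ

/-- The mean functional `∫ x P(dx)` of a random measure `P`. If `P` is a Dirichlet process with
parameters `(θ, F)`, this is the random variable `M_θ(F)`. -/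
def meanFunctional {Ω : Type*} (P : Ω → Measure ℝ) (ω : Ω) : ℝ :=
  ∫ x, x ∂(P ω)

/-- The Lévy exponent `ψ_F(lam) = ∫ log (1 + lam x) F(dx)`. -/
def levyExponent (F : Measure ℝ) (lam : ℝ) : ℝ :=
  ∫ x, Real.log (1 + lam * x) ∂F

/-- `Φ_F(t) = ∫ log |t - x| 1(t ≠ x) F(dx)`. -/
def logPotential (F : Measure ℝ) (t : ℝ) : ℝ :=
  ∫ x, Set.indicator {x : ℝ | t ≠ x} (fun x => Real.log |t - x|) x ∂F

/-- The (Lebesgue) density of the law `ν` is `f` on `S` and zero off `S`. -/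
def HasDensityOn (ν : Measure ℝ) (S : Set ℝ) (f : ℝ → ℝ) : Prop :=
  ν = (volume.restrict S).withDensity fun x => ENNReal.ofReal (f x)

/-- `A_c = c X / (c X + 1)`. -/
def tiltVar {Ω : Type*} (c : ℝ) (X : Ω → ℝ) (ω : Ω) : ℝ :=
  c * X ω / (c * X ω + 1)

end

/-! Both laws in each part are identified through their Stieltjes transform of order one, and a
single inversion theorem then gives both the same density.

The transform comes from the Markov–Krein identity E[(1 + c M_θ(F))^(-θ)] = exp(-θ ψ_F(c)). For a
finite partition it is a statement about Dirichlet vectors (`lintegral_dirichletLaw_rpow`), proved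
from gamma variables by scaling and Fubini; simple functions and a monotone limit give the general
case (`IsDirichletProcess.lintegral_rpow`). Letting c → 0 shows that the mean is almost surely
finite.

The law of X Y_σ is G = σ F_X + (1 - σ) δ₀, so ψ_G = σ ψ_{F_X}, and M_1(G) has transform exp(-σ
ψ_{F_X}(c)). A beta(σ, 1 - σ) variable satisfies E[(1 + zβ)⁻¹] = (1 + z)^(-σ)
(`lintegral_betaLaw_inv`). Conditioning on the mean therefore gives β M_σ(F_X) the same transform.
The same argument applies to A_c.

For the inversion (`HasMarkovTransform.eq_withDensity`), the identity ∫ (x + w)⁻¹ ν(dx) = exp(-∫ log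
(x + w) G(dx)) is continued to the slit plane. Its imaginary part at w = -t - iε is the Poisson
integral of ν; as ε → 0 the right side tends to exp(-Φ_G(t)) sin(π G(t)) for almost every t. Passing
to the limit against test functions requires a locally integrable bound uniform in ε, namely exp(-∫
log |t - x| G(dx)). Its local integrability is where the absence of a unit atom enters: near each
point G has mass m < 1, and Jensen's inequality bounds the exponential by a convolution of G with
|u|^(-m).

Finally x ↦ c x / (c x + 1) is a Möbius map fixing 0. It transports distribution functions directly
and changes logarithmic potentials by explicit terms (`logPotential_map_tiltMap`), which converts
the inversion formula into the stated densities. -/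

open Filter Topology

/-! ### Gamma laws and the Dirichlet law -/

lemma lintegral_comp_const_mul {c : ℝ} (hc : 0 < c) {f : ℝ → ENNReal} (hf : Measurable f) :
    ∫⁻ x, f (c * x) = ENNReal.ofReal c⁻¹ * ∫⁻ x, f x := by
  have h := Real.map_volume_mul_left hc.ne'
  rw [abs_of_pos (inv_pos.2 hc)] at h
  rw [← lintegral_map hf (measurable_const_mul c), h, lintegral_smul_measure, smul_eq_mul]

lemma setLIntegral_Ioi_comp_inv (f : ℝ → ENNReal) :
    ∫⁻ x in Set.Ioi (0 : ℝ), f x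
      = ∫⁻ x in Set.Ioi (0 : ℝ), ENNReal.ofReal (x ^ 2)⁻¹ * f x⁻¹ := by
  have himg : (fun x : ℝ => x⁻¹) '' Set.Ioi 0 = Set.Ioi 0 := by
    ext x; simp [Set.image_inv_eq_inv]
  have h := lintegral_image_eq_lintegral_abs_deriv_mul (s := Set.Ioi (0 : ℝ))
    (f := fun x => x⁻¹) (f' := fun x => -(x ^ 2)⁻¹) measurableSet_Ioi
    (fun x hx => (hasDerivAt_inv (ne_of_gt hx)).hasDerivWithinAt)
    (fun x _ y _ hxy => inv_injective hxy) f
  rw [himg] at h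
  rw [h]
  refine lintegral_congr fun x => ?_
  rw [abs_neg, abs_of_nonneg (by positivity)]

lemma lintegral_rpow_mul_exp_neg {θ r : ℝ} (hθ : 0 < θ) (hr : 0 < r) :
    ∫⁻ v in Set.Ioi (0 : ℝ), ENNReal.ofReal (v ^ (θ - 1) * Real.exp (-(r * v)))
      = ENNReal.ofReal (r ^ (-θ) * Real.Gamma θ) := by
  have h := Real.integral_rpow_mul_exp_neg_mul_Ioi hθ hr
  have hpos : 0 < (1 / r) ^ θ * Real.Gamma θ := by
    have := Real.Gamma_pos_of_pos hθ
    positivity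
  -- A non-integrable function has Bochner integral 0, so the positive value in `h` already forces
  -- integrability.
  have hint : IntegrableOn (fun v : ℝ => v ^ (θ - 1) * Real.exp (-(r * v))) (Set.Ioi 0) := by
    by_contra hni
    rw [integral_undef hni] at h
    exact hpos.ne h
  rw [← ofReal_integral_eq_lintegral_ofReal hint, h, Real.rpow_neg hr.le, one_div,
    Real.inv_rpow hr.le]
  refine (ae_restrict_iff' measurableSet_Ioi).2 (ae_of_all _ fun v hv => ?_)
  have : (0 : ℝ) < v := hv
  simp only [Pi.zero_apply]
  positivity

lemma isProbabilityMeasure_unitGammaLaw {a : ℝ} (ha : 0 ≤ a) :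
    IsProbabilityMeasure (unitGammaLaw a) := by
  unfold unitGammaLaw
  split_ifs with h
  · infer_instance
  · exact isProbabilityMeasure_gammaMeasure (lt_of_le_of_ne ha (Ne.symm h)) one_pos

lemma lintegral_gammaMeasure {a : ℝ} {f : ℝ → ENNReal} (hf : Measurable f) :
    ∫⁻ x, f x ∂gammaMeasure a 1 = ∫⁻ x, gammaPDF a 1 x * f x := by
  have : Measurable (gammaPDF a 1) := (measurable_gammaPDFReal a 1).ennreal_ofReal
  rw [gammaMeasure, lintegral_withDensity_eq_lintegral_mul _ this hf]
  rfl

/-- The behaviour of the gamma law under scaling, with the exponential tilt on the right. -/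
lemma lintegral_unitGammaLaw_comp_const_mul {a c : ℝ} (ha : 0 ≤ a) (hc : 0 < c)
    {f : ℝ → ENNReal} (hf : Measurable f) :
    ENNReal.ofReal (c ^ a) * ∫⁻ x, f (c * x) ∂unitGammaLaw a
      = ∫⁻ x, ENNReal.ofReal (Real.exp ((1 - c⁻¹) * x)) * f x ∂unitGammaLaw a := by
  unfold unitGammaLaw
  split_ifs with h
  · have h1 : Measurable fun x => f (c * x) := hf.comp (measurable_const_mul c)
    have h2 : Measurable fun x => ENNReal.ofReal (Real.exp ((1 - c⁻¹) * x)) * f x := by fun_prop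
    rw [lintegral_dirac' _ h1, lintegral_dirac' _ h2]
    simp [h]
  · have ha' : 0 < a := lt_of_le_of_ne ha (Ne.symm h)
    have hm : Measurable (gammaPDF a 1) := (measurable_gammaPDFReal a 1).ennreal_ofReal
    rw [lintegral_gammaMeasure (by fun_prop), lintegral_gammaMeasure (by fun_prop)]
    have h1 := lintegral_comp_const_mul hc
      (f := fun y => gammaPDF a 1 (c⁻¹ * y) * f y) (by fun_prop)
    simp only [inv_mul_cancel_left₀ hc.ne'] at h1
    rw [h1, ← mul_assoc, ← ENNReal.ofReal_mul (by positivity),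
      ← lintegral_const_mul' _ _ ENNReal.ofReal_ne_top]
    refine lintegral_congr fun y => ?_
    rw [← mul_assoc, ← mul_assoc]
    congr 1
    rcases lt_or_ge y 0 with hy | hy
    · rw [gammaPDF_of_neg hy, gammaPDF_of_neg (mul_neg_of_pos_of_neg (inv_pos.2 hc) hy)]
      simp
    · rw [gammaPDF_of_nonneg hy, gammaPDF_of_nonneg (by positivity),
        ← ENNReal.ofReal_mul (by positivity), ← ENNReal.ofReal_mul (by
          have := Real.Gamma_pos_of_pos ha'
          positivity)]
      congr 1
      have h3 : (c⁻¹ * y) ^ (a - 1) = c * (c ^ a)⁻¹ * y ^ (a - 1) := by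
        rw [Real.mul_rpow (by positivity) hy, Real.inv_rpow hc.le, Real.rpow_sub_one hc.ne']
        field_simp
      have h4 : Real.exp (-(1 * y)) * Real.exp ((1 - c⁻¹) * y) = Real.exp (-(1 * (c⁻¹ * y))) := by
        rw [← Real.exp_add]; ring_nf
      have h5 : c ^ a ≠ 0 := by positivity
      rw [h3, mul_assoc _ (Real.exp (-(1 * y))), h4]
      field_simp

lemma ae_unitGammaLaw_nonneg (a : ℝ) : ∀ᵐ x ∂unitGammaLaw a, 0 ≤ x := by
  unfold unitGammaLaw
  split_ifs
  · simp [ae_dirac_eq]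
  · have hm : Measurable (gammaPDF a 1) := (measurable_gammaPDFReal a 1).ennreal_ofReal
    rw [gammaMeasure, ae_withDensity_iff hm]
    refine ae_of_all _ fun x hx => ?_
    by_contra hneg
    exact hx (gammaPDF_of_neg (not_le.1 hneg))

lemma ae_unitGammaLaw_pos {a : ℝ} (ha : 0 < a) : ∀ᵐ x ∂unitGammaLaw a, 0 < x := by
  have h0 : ∀ᵐ x ∂unitGammaLaw a, x ≠ 0 := by
    rw [unitGammaLaw, if_neg ha.ne', gammaMeasure]
    exact (withDensity_absolutelyContinuous _ _).ae_le (compl_mem_ae_iff.2 (measure_singleton 0))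
  filter_upwards [ae_unitGammaLaw_nonneg a, h0] with x h1 h2
  exact lt_of_le_of_ne h1 (Ne.symm h2)

lemma lintegral_pi_prod {k : ℕ} (γ : Fin k → Measure ℝ) [∀ i, IsProbabilityMeasure (γ i)]
    {φ : Fin k → ℝ → ENNReal} (hφ : ∀ i, Measurable (φ i)) :
    ∫⁻ g, ∏ i, φ i (g i) ∂Measure.pi γ = ∏ i, ∫⁻ x, φ i x ∂γ i := by
  have h := lintegral_prod_eq_prod_lintegral_of_indepFun Finset.univ
    (fun i (g : Fin k → ℝ) => φ i (g i))
    (iIndepFun_pi (μ := γ) (X := φ) fun i => (hφ i).aemeasurable)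
    (fun i => (hφ i).comp (measurable_pi_apply i))
  rw [h]
  refine Finset.prod_congr rfl fun i _ => ?_
  exact (measurePreserving_eval γ i).lintegral_comp (hφ i)

/-- The tilt by the exponential of the total factorises over coordinates, so the one-variable
scaling identity makes the scaled and the tilted product measures agree on boxes. -/
lemma lintegral_pi_unitGammaLaw_comp_const_mul {k : ℕ} {a : Fin k → ℝ} (ha : ∀ i, 0 ≤ a i)
    {c : ℝ} (hc : 0 < c) {f : (Fin k → ℝ) → ENNReal} (hf : Measurable f) :
    ENNReal.ofReal (c ^ ∑ i, a i) *
        ∫⁻ g, f (fun i => c * g i) ∂Measure.pi (fun i => unitGammaLaw (a i))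
      = ∫⁻ g, ENNReal.ofReal (Real.exp ((1 - c⁻¹) * ∑ i, g i)) * f g
          ∂Measure.pi (fun i => unitGammaLaw (a i)) := by
  have hp : ∀ i, IsProbabilityMeasure (unitGammaLaw (a i)) :=
    fun i => isProbabilityMeasure_unitGammaLaw (ha i)
  set γ : Fin k → Measure ℝ := fun i => unitGammaLaw (a i)
  have hpm : ∀ i, IsProbabilityMeasure ((γ i).map (c * ·)) :=
    fun i => Measure.isProbabilityMeasure_map (measurable_const_mul c).aemeasurable
  have hmd : Measurable fun g : Fin k → ℝ =>
      ENNReal.ofReal (Real.exp ((1 - c⁻¹) * ∑ i, g i)) := by fun_prop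
  have hms : Measurable fun g : Fin k → ℝ => fun i => c * g i := by fun_prop
  have hmd1 : Measurable fun x : ℝ => ENNReal.ofReal (Real.exp ((1 - c⁻¹) * x)) := by fun_prop
  have hcpos : ∀ b : ℝ, ENNReal.ofReal (c ^ b) ≠ 0 := fun b => by
    simpa using Real.rpow_pos_of_pos hc b
  have key : Measure.pi (fun i => (γ i).map (c * ·)) =
      (ENNReal.ofReal (c ^ ∑ i, a i))⁻¹ • (Measure.pi γ).withDensity
        (fun g => ENNReal.ofReal (Real.exp ((1 - c⁻¹) * ∑ i, g i))) := by
    refine Measure.pi_eq fun s hs => ?_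
    have h1 : ∀ i, (γ i).map (c * ·) (s i) = (ENNReal.ofReal (c ^ a i))⁻¹ *
        ∫⁻ x, (s i).indicator (fun x => ENNReal.ofReal (Real.exp ((1 - c⁻¹) * x))) x ∂γ i := by
      intro i
      have h2 := lintegral_unitGammaLaw_comp_const_mul (ha i) hc
        (f := (s i).indicator 1) (measurable_one.indicator (hs i))
      rw [← lintegral_map (measurable_one.indicator (hs i)) (measurable_const_mul c),
        lintegral_indicator_one (hs i)] at h2
      have h3 : ∀ x : ℝ, ENNReal.ofReal (Real.exp ((1 - c⁻¹) * x)) * (s i).indicator 1 x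
          = (s i).indicator (fun x => ENNReal.ofReal (Real.exp ((1 - c⁻¹) * x))) x := by
        intro x
        by_cases hx : x ∈ s i <;> simp [hx]
      simp only [h3] at h2
      rw [← h2, ← mul_assoc, ENNReal.inv_mul_cancel (hcpos _) ENNReal.ofReal_ne_top, one_mul]
    rw [Measure.smul_apply, withDensity_apply _ (MeasurableSet.univ_pi hs), smul_eq_mul,
      Finset.prod_congr rfl fun i _ => h1 i, Finset.prod_mul_distrib,
      ← lintegral_pi_prod γ fun i => hmd1.indicator (hs i),
      ← lintegral_indicator (MeasurableSet.univ_pi hs)]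
    congr 1
    · have h4 : ∀ b : ℝ, (ENNReal.ofReal (c ^ b))⁻¹ = ENNReal.ofReal (c ^ b)⁻¹ :=
        fun b => (ENNReal.ofReal_inv_of_pos (Real.rpow_pos_of_pos hc b)).symm
      simp only [h4]
      rw [← ENNReal.ofReal_prod_of_nonneg fun i _ => (inv_pos.2 (Real.rpow_pos_of_pos hc _)).le,
        Finset.prod_inv_distrib, Real.rpow_sum_of_pos hc]
    · refine lintegral_congr fun g => ?_
      by_cases hg : g ∈ Set.univ.pi s
      · rw [Set.indicator_of_mem hg, Finset.mul_sum, Real.exp_sum,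
          ENNReal.ofReal_prod_of_nonneg fun i _ => (Real.exp_pos _).le]
        exact (Finset.prod_congr rfl fun i _ =>
          (Set.indicator_of_mem (hg i (Set.mem_univ i))
            (fun x => ENNReal.ofReal (Real.exp ((1 - c⁻¹) * x)))).symm)
      · rw [Set.indicator_of_notMem hg]
        simp only [Set.mem_pi, Set.mem_univ, true_implies, not_forall] at hg
        obtain ⟨i, hi⟩ := hg
        exact (Finset.prod_eq_zero (Finset.mem_univ i) (Set.indicator_of_notMem hi _)).symm
  have hmap : (Measure.pi γ).map (fun g i => c * g i) = Measure.pi (fun i => (γ i).map (c * ·)) :=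
    Measure.pi_map_pi fun i => (measurable_const_mul c).aemeasurable
  rw [← lintegral_map hf hms, hmap, key, lintegral_smul_measure,
    lintegral_withDensity_eq_lintegral_mul _ hmd hf, smul_eq_mul, ← mul_assoc,
    ENNReal.mul_inv_cancel (hcpos _) ENNReal.ofReal_ne_top, one_mul]
  rfl

/-- This is the scaling identity for the constant 1: with c = 1 / (1 + f) the tilt 1 - c⁻¹ equals
-f. -/
lemma lintegral_exp_neg_mul_unitGammaLaw {a f : ℝ} (ha : 0 ≤ a) (hf : 0 ≤ f) :
    ∫⁻ x, ENNReal.ofReal (Real.exp (-(f * x))) ∂unitGammaLaw a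
      = ENNReal.ofReal ((1 + f) ^ (-a)) := by
  have := isProbabilityMeasure_unitGammaLaw ha
  have h := lintegral_unitGammaLaw_comp_const_mul ha (c := (1 + f)⁻¹) (by positivity)
    (f := fun _ => 1) measurable_const
  simp only [lintegral_one, measure_univ, mul_one, inv_inv] at h
  rw [Real.rpow_neg (by positivity), ← Real.inv_rpow (by positivity), h]
  refine lintegral_congr fun x => ?_
  ring_nf

/-- The Laplace functional of independent gamma variables as a Stieltjes functional of their
normalisation. -/
lemma lintegral_pi_gamma_ratio {k : ℕ} {a f : Fin k → ℝ} (ha : ∀ i, 0 ≤ a i)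
    (hθ : 0 < ∑ i, a i) (hf : ∀ i, 0 ≤ f i) :
    ∫⁻ g, ENNReal.ofReal ((∑ i, g i) ^ (∑ i, a i) *
        (∑ i, g i + ∑ i, f i * g i) ^ (-∑ i, a i)) ∂Measure.pi (fun i => unitGammaLaw (a i))
      = ∫⁻ g, ENNReal.ofReal (Real.exp (-∑ i, f i * g i))
          ∂Measure.pi (fun i => unitGammaLaw (a i)) := by
  have hp : ∀ i, IsProbabilityMeasure (unitGammaLaw (a i)) :=
    fun i => isProbabilityMeasure_unitGammaLaw (ha i)
  have hnn : ∀ᵐ g ∂Measure.pi (fun i => unitGammaLaw (a i)), ∀ i, 0 ≤ g i :=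
    ae_all_iff.2 fun i =>
      (Measure.quasiMeasurePreserving_eval (fun i => unitGammaLaw (a i)) i).ae
        (ae_unitGammaLaw_nonneg (a i))
  obtain ⟨j, -, hj⟩ : ∃ j ∈ Finset.univ, 0 < a j := by
    by_contra! hcon
    exact hθ.not_ge (Finset.sum_nonpos hcon)
  have hjpos : ∀ᵐ g ∂Measure.pi (fun i => unitGammaLaw (a i)), 0 < g j :=
    (Measure.quasiMeasurePreserving_eval (fun i => unitGammaLaw (a i)) j).ae
      (ae_unitGammaLaw_pos hj)
  set θ := ∑ i, a i
  set Γ := Measure.pi (fun i => unitGammaLaw (a i))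
  have hS : ∀ᵐ g ∂Γ, 0 < ∑ i, g i ∧ 0 ≤ ∑ i, f i * g i := by
    filter_upwards [hnn, hjpos] with g h1 h2
    exact ⟨Finset.sum_pos' (fun i _ => h1 i) ⟨j, Finset.mem_univ j, h2⟩,
      Finset.sum_nonneg fun i _ => mul_nonneg (hf i) (h1 i)⟩
  have hG := Real.Gamma_pos_of_pos hθ
  have hG0 : ENNReal.ofReal (Real.Gamma θ) ≠ 0 := by simpa using hG
  -- A factor Γ(θ) turns each side into an integral over v > 0: on the left Γ(θ) r^(-θ) = ∫ v^(θ-1)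
  -- e^(-rv) dv with r the sum of the two totals, on the right the same formula with r = ∑ g. No
  -- independence of the total and the normalised vector is needed.
  refine (ENNReal.mul_right_inj hG0 ENNReal.ofReal_ne_top).1 ?_
  have hL : ENNReal.ofReal (Real.Gamma θ) * ∫⁻ g, ENNReal.ofReal ((∑ i, g i) ^ θ *
        (∑ i, g i + ∑ i, f i * g i) ^ (-θ)) ∂Γ
      = ∫⁻ v in Set.Ioi (0 : ℝ), ∫⁻ g, ENNReal.ofReal ((∑ i, g i) ^ θ *
          (v ^ (θ - 1) * Real.exp (-((∑ i, g i + ∑ i, f i * g i) * v)))) ∂Γ := by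
    rw [← lintegral_const_mul' _ _ ENNReal.ofReal_ne_top, lintegral_lintegral_swap (by fun_prop)]
    refine lintegral_congr_ae ?_
    filter_upwards [hS] with g hg
    have h1 := lintegral_rpow_mul_exp_neg hθ (r := ∑ i, g i + ∑ i, f i * g i) (by linarith)
    have h2 : 0 ≤ (∑ i, g i) ^ θ := by have := hg.1; positivity
    simp only [ENNReal.ofReal_mul h2]
    rw [lintegral_const_mul' _ _ ENNReal.ofReal_ne_top, h1, mul_left_comm,
      ENNReal.ofReal_mul (Real.rpow_nonneg (by linarith) _), mul_comm (ENNReal.ofReal _)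
        (ENNReal.ofReal (Real.Gamma θ))]
  have hR : ENNReal.ofReal (Real.Gamma θ) * ∫⁻ g, ENNReal.ofReal (Real.exp (-∑ i, f i * g i)) ∂Γ
      = ∫⁻ v in Set.Ioi (0 : ℝ), ∫⁻ g, ENNReal.ofReal (Real.exp (-∑ i, f i * g i) *
          ((∑ i, g i) ^ θ * (v ^ (θ - 1) * Real.exp (-((∑ i, g i) * v))))) ∂Γ := by
    rw [← lintegral_const_mul' _ _ ENNReal.ofReal_ne_top, lintegral_lintegral_swap (by fun_prop)]
    refine lintegral_congr_ae ?_
    filter_upwards [hS] with g hg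
    have h1 := lintegral_rpow_mul_exp_neg hθ (r := ∑ i, g i) hg.1
    have h2 : 0 ≤ (∑ i, g i) ^ θ := by have := hg.1; positivity
    simp only [ENNReal.ofReal_mul h2, ENNReal.ofReal_mul (Real.exp_pos _).le]
    rw [lintegral_const_mul' _ _ ENNReal.ofReal_ne_top,
      lintegral_const_mul' _ _ ENNReal.ofReal_ne_top, h1, ← ENNReal.ofReal_mul h2,
      ← mul_assoc, Real.rpow_neg hg.1.le, mul_inv_cancel₀ (Real.rpow_pos_of_pos hg.1 _).ne',
      one_mul, mul_comm]
  -- After v ↦ 1/v on the left, the two integrands agree for each fixed v by scaling the gamma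
  -- vector.
  rw [hL, hR, setLIntegral_Ioi_comp_inv]
  refine setLIntegral_congr_fun measurableSet_Ioi fun v hv => ?_
  have hv : 0 < v := hv
  -- The scale v⁻¹ produces the tilt exp((1 - v) ∑ g), which turns e^(-∑ g) into e^(-v ∑ g).
  have hsc := lintegral_pi_unitGammaLaw_comp_const_mul ha (c := v⁻¹) (inv_pos.2 hv)
    (f := fun g => ENNReal.ofReal (Real.exp (-∑ i, f i * g i) *
      ((∑ i, g i) ^ θ * (v ^ (θ - 1) * Real.exp (-(∑ i, g i))))))
    (by fun_prop)
  rw [inv_inv] at hsc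
  have e1 : ∀ g : Fin k → ℝ, ENNReal.ofReal (Real.exp (-∑ i, f i * g i) *
          ((∑ i, g i) ^ θ * (v ^ (θ - 1) * Real.exp (-((∑ i, g i) * v)))))
      = ENNReal.ofReal (Real.exp ((1 - v) * ∑ i, g i)) *
        ENNReal.ofReal (Real.exp (-∑ i, f i * g i) *
      ((∑ i, g i) ^ θ * (v ^ (θ - 1) * Real.exp (-(∑ i, g i))))) := by
    intro g
    rw [← ENNReal.ofReal_mul (Real.exp_pos _).le]
    have : Real.exp (-((∑ i, g i) * v)) =
      Real.exp ((1 - v) * ∑ i, g i) * Real.exp (-(∑ i, g i)) := by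
        rw [← Real.exp_add]; ring_nf
    rw [this]; ring_nf
  simp only [e1]
  refine Eq.trans ?_ hsc
  rw [← lintegral_const_mul' _ _ ENNReal.ofReal_ne_top,
    ← lintegral_const_mul' _ _ ENNReal.ofReal_ne_top]
  refine lintegral_congr_ae ?_
  filter_upwards [hS] with g hg
  rw [← ENNReal.ofReal_mul (by positivity), ← ENNReal.ofReal_mul (by positivity)]
  congr 1
  have h3 : ∑ i, v⁻¹ * g i = v⁻¹ * ∑ i, g i := by rw [Finset.mul_sum]
  have h4 : ∑ i, f i * (v⁻¹ * g i) = v⁻¹ * ∑ i, f i * g i := by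
    rw [Finset.mul_sum]; exact Finset.sum_congr rfl fun i _ => by ring
  have h5 : Real.exp (-((∑ i, g i + ∑ i, f i * g i) * v⁻¹))
      = Real.exp (-(v⁻¹ * ∑ i, f i * g i)) * Real.exp (-(v⁻¹ * ∑ i, g i)) := by
    rw [← Real.exp_add]; ring_nf
  rw [h3, h4, h5, Real.mul_rpow (inv_pos.2 hv).le hg.1.le, Real.inv_rpow hv.le,
    Real.inv_rpow hv.le, Real.rpow_sub_one hv.ne']
  have h6 : v ^ θ ≠ 0 := (Real.rpow_pos_of_pos hv _).ne'
  field_simp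
  rfl

/-- The Stieltjes functional of a Dirichlet vector. -/
lemma lintegral_dirichletLaw_rpow {k : ℕ} {a f : Fin k → ℝ} (ha : ∀ i, 0 ≤ a i)
    (hθ : 0 < ∑ i, a i) (hf : ∀ i, 0 ≤ f i) :
    ∫⁻ d, ENNReal.ofReal ((1 + ∑ i, f i * d i) ^ (-∑ i, a i)) ∂dirichletLaw a
      = ENNReal.ofReal (∏ i, (1 + f i) ^ (-a i)) := by
  have hp : ∀ i, IsProbabilityMeasure (unitGammaLaw (a i)) :=
    fun i => isProbabilityMeasure_unitGammaLaw (ha i)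
  have hnn : ∀ᵐ g ∂Measure.pi (fun i => unitGammaLaw (a i)), ∀ i, 0 ≤ g i :=
    ae_all_iff.2 fun i =>
      (Measure.quasiMeasurePreserving_eval (fun i => unitGammaLaw (a i)) i).ae
        (ae_unitGammaLaw_nonneg (a i))
  obtain ⟨j, -, hj⟩ : ∃ j ∈ Finset.univ, 0 < a j := by
    by_contra! hcon
    exact hθ.not_ge (Finset.sum_nonpos hcon)
  have hjpos : ∀ᵐ g ∂Measure.pi (fun i => unitGammaLaw (a i)), 0 < g j :=
    (Measure.quasiMeasurePreserving_eval (fun i => unitGammaLaw (a i)) j).ae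
      (ae_unitGammaLaw_pos hj)
  rw [dirichletLaw, lintegral_map (by fun_prop) (by fun_prop)]
  have h1 := lintegral_pi_gamma_ratio ha hθ hf
  have h2 := lintegral_pi_prod (fun i => unitGammaLaw (a i))
    (φ := fun i x => ENNReal.ofReal (Real.exp (-(f i * x)))) (fun i => by fun_prop)
  simp only [lintegral_exp_neg_mul_unitGammaLaw (ha _) (hf _)] at h2
  rw [ENNReal.ofReal_prod_of_nonneg fun i _ => Real.rpow_nonneg (by linarith [hf i]) _, ← h2]
  simp only [← ENNReal.ofReal_prod_of_nonneg fun _ _ => (Real.exp_pos _).le, ← Real.exp_sum,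
    Finset.sum_neg_distrib]
  rw [← h1]
  refine lintegral_congr_ae ?_
  filter_upwards [hnn, hjpos] with g g1 g2
  have hS : 0 < ∑ i, g i := Finset.sum_pos' (fun i _ => g1 i) ⟨j, Finset.mem_univ j, g2⟩
  have hR : 0 ≤ ∑ i, f i * g i := Finset.sum_nonneg fun i _ => mul_nonneg (hf i) (g1 i)
  have h3 : 1 + ∑ i, f i * (g i / ∑ j, g j)
      = (∑ i, g i)⁻¹ * (∑ i, g i + ∑ i, f i * g i) := by
    simp only [← mul_div_assoc, ← Finset.sum_div]
    field_simp
  rw [h3, Real.mul_rpow (inv_pos.2 hS).le (by linarith), Real.rpow_neg (inv_pos.2 hS).le,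
    Real.inv_rpow hS.le, inv_inv]

/-! ### The Markov–Krein identity for Dirichlet means -/

lemma integral_comp_simpleFunc {g : SimpleFunc ℝ ℝ} (m : Measure ℝ) [IsFiniteMeasure m]
    {φ : ℝ → ℝ} (hφ : φ 0 = 0) :
    ∫ x, φ (g x) ∂m = ∑ i : Fin g.range.card,
      φ (g.range.equivFin.symm i) * m.real (g ⁻¹' {(g.range.equivFin.symm i : ℝ)}) := by
  have hg : Integrable g m := g.integrable_of_isFiniteMeasure
  have h1 := SimpleFunc.map_integral g φ hg hφ
  have h2 : Integrable (g.map φ) m := (g.map φ).integrable_of_isFiniteMeasure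
  rw [SimpleFunc.integral_eq_integral _ h2] at h1
  have h3 : ∫ x, φ (g x) ∂m = ∫ x, (g.map φ) x ∂m := by simp
  rw [h3, h1, ← Finset.sum_coe_sort,
    ← Equiv.sum_comp g.range.equivFin.symm]
  exact Finset.sum_congr rfl fun i _ => by rw [smul_eq_mul, mul_comm]

lemma ofReal_one_add_rpow {r θ : ℝ} (hr : 0 ≤ r) :
    (1 + ENNReal.ofReal r) ^ (-θ) = ENNReal.ofReal ((1 + r) ^ (-θ)) := by
  rw [← ENNReal.ofReal_one, ← ENNReal.ofReal_add zero_le_one hr,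
    ENNReal.ofReal_rpow_of_pos (by linarith)]

namespace IsDirichletProcess

variable {Ω : Type*} [MeasurableSpace Ω] {θ : ℝ} {F : Measure ℝ} {P : Ω → Measure ℝ}
  {μ : Measure Ω}

lemma measurable_lintegral (hP : IsDirichletProcess θ F P μ) {f : ℝ → ENNReal}
    (hf : Measurable f) : Measurable fun ω => ∫⁻ x, f x ∂P ω :=
  (Measure.measurable_lintegral hf).comp hP.measurable

/-- The fibres of `g` form a finite partition, so the integral of `g` against `P` is a linear form
in a Dirichlet vector. -/
lemma lintegral_rpow_simpleFunc [IsProbabilityMeasure F] (hP : IsDirichletProcess θ F P μ)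
    (hθ : 0 < θ) (g : SimpleFunc ℝ ℝ) (hg : ∀ x, 0 ≤ g x) :
    ∫⁻ ω, (1 + ∫⁻ x, ENNReal.ofReal (g x) ∂P ω) ^ (-θ) ∂μ
      = ENNReal.ofReal (Real.exp (-θ * ∫ x, Real.log (1 + g x) ∂F)) := by
  have := hP.isProbabilityMeasure
  set f : Fin g.range.card → ℝ := fun i => (g.range.equivFin.symm i : ℝ)
  set C : Fin g.range.card → Set ℝ := fun i => g ⁻¹' {f i}
  have hfinj : Function.Injective f :=
    Subtype.val_injective.comp g.range.equivFin.symm.injective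
  have hf0 : ∀ i, 0 ≤ f i := by
    intro i
    obtain ⟨x, hx⟩ := SimpleFunc.mem_range.1 (g.range.equivFin.symm i).2
    exact (hg x).trans_eq hx
  have hC : ∀ i, MeasurableSet (C i) := fun i => g.measurableSet_fiber _
  have hdisj : Pairwise (fun i j => Disjoint (C i) (C j)) := by
    intro i j hij
    refine Set.disjoint_left.2 fun x hi hj => hij (hfinj ?_)
    simp only [C, Set.mem_preimage, Set.mem_singleton_iff] at hi hj
    exact hi.symm.trans hj
  have hU : (⋃ i, C i) = Set.univ := by
    refine Set.eq_univ_of_forall fun x => Set.mem_iUnion.2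
      ⟨g.range.equivFin ⟨g x, g.mem_range_self x⟩, ?_⟩
    simp [C, f]
  have hlaw := hP.hasLaw_partition _ C hC hdisj hU
  have hFsum : ∑ i, θ * F.real (C i) = θ := by
    rw [← Finset.mul_sum, ← measureReal_iUnion_fintype hdisj hC, hU, probReal_univ, mul_one]
  have hint : ∀ ω, (1 + ∫⁻ x, ENNReal.ofReal (g x) ∂P ω) ^ (-θ)
      = ENNReal.ofReal ((1 + ∑ i, f i * (P ω).real (C i)) ^ (-θ)) := by
    intro ω
    have h1 := integral_comp_simpleFunc (g := g) (P ω) (φ := fun x => x) rfl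
    rw [← ofReal_integral_eq_lintegral_ofReal g.integrable_of_isFiniteMeasure
      (ae_of_all _ hg), h1, ofReal_one_add_rpow]
    exact Finset.sum_nonneg fun i _ => mul_nonneg (hf0 i) measureReal_nonneg
  have hD := lintegral_dirichletLaw_rpow (a := fun i => θ * F.real (C i)) (f := f)
    (fun i => by positivity) (by rw [hFsum]; exact hθ) hf0
  have hmeas : Measurable fun d : Fin g.range.card → ℝ =>
      ENNReal.ofReal ((1 + ∑ i, f i * d i) ^ (-θ)) := by fun_prop
  rw [hFsum, ← hlaw.map_eq, lintegral_map' hmeas.aemeasurable hlaw.aemeasurable] at hD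
  rw [lintegral_congr hint, hD,
    integral_comp_simpleFunc (g := g) F (φ := fun x => Real.log (1 + x)) (by simp), Finset.mul_sum,
    Real.exp_sum]
  congr 1
  refine Finset.prod_congr rfl fun i _ => ?_
  rw [Real.rpow_def_of_pos (by linarith [hf0 i])]
  congr 1
  change Real.log (1 + f i) * -(θ * F.real (C i)) = -θ * (Real.log (1 + f i) * F.real (C i))
  ring

/-- The Markov–Krein identity. -/
lemma lintegral_rpow [IsProbabilityMeasure F] [IsProbabilityMeasure μ]
    (hP : IsDirichletProcess θ F P μ) (hθ : 0 < θ) {f : ℝ → ℝ} (hf : Measurable f)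
    (hf0 : ∀ x, 0 ≤ f x) (hlog : Integrable (fun x => Real.log (1 + f x)) F) :
    ∫⁻ ω, (1 + ∫⁻ x, ENNReal.ofReal (f x) ∂P ω) ^ (-θ) ∂μ
      = ENNReal.ofReal (Real.exp (-θ * ∫ x, Real.log (1 + f x) ∂F)) := by
  set e : ℕ → SimpleFunc ℝ ENNReal := SimpleFunc.eapprox fun x => ENNReal.ofReal (f x)
  have hfm : Measurable fun x => ENNReal.ofReal (f x) := hf.ennreal_ofReal
  set g : ℕ → SimpleFunc ℝ ℝ := fun n => (e n).map ENNReal.toReal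
  have hge : ∀ n x, ENNReal.ofReal (g n x) = e n x := fun n x =>
    ENNReal.ofReal_toReal (SimpleFunc.eapprox_lt_top _ n x).ne
  have hg0 : ∀ n x, 0 ≤ g n x := fun n x => ENNReal.toReal_nonneg
  have hsup : ∀ x, ⨆ n, e n x = ENNReal.ofReal (f x) := fun x =>
    SimpleFunc.iSup_eapprox_apply hfm x
  have hmono : ∀ x, Monotone fun n => e n x := fun x _ _ h =>
    SimpleFunc.monotone_eapprox _ h x
  have htend : ∀ x, Tendsto (fun n => e n x) atTop (𝓝 (ENNReal.ofReal (f x))) := fun x =>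
    hsup x ▸ tendsto_atTop_iSup (hmono x)
  have hgle : ∀ n x, g n x ≤ f x := fun n x =>
    ENNReal.toReal_le_of_le_ofReal (hf0 x) (hsup x ▸ le_iSup (fun n => e n x) n)
  have hgt : ∀ x, Tendsto (fun n => g n x) atTop (𝓝 (f x)) := by
    intro x
    have := (ENNReal.tendsto_toReal ENNReal.ofReal_ne_top).comp (htend x)
    rwa [ENNReal.toReal_ofReal (hf0 x)] at this
  -- The exponent is negative, so the integrands are bounded by 1. Working in `ENNReal` allows an
  -- infinite limiting mean, which contributes 0.
  have hL : Tendsto (fun n => ∫⁻ ω, (1 + ∫⁻ x, ENNReal.ofReal (g n x) ∂P ω) ^ (-θ) ∂μ) atTop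
      (𝓝 (∫⁻ ω, (1 + ∫⁻ x, ENNReal.ofReal (f x) ∂P ω) ^ (-θ) ∂μ)) := by
    refine tendsto_lintegral_of_dominated_convergence (fun _ => 1) (fun n => ?_)
      (fun n => ae_of_all _ fun ω => ?_) (by simp) (ae_of_all _ fun ω => ?_)
    · exact (measurable_const.add (hP.measurable_lintegral
        (g n).measurable.ennreal_ofReal)).pow_const _
    · exact ENNReal.rpow_le_one_of_one_le_of_neg le_self_add (neg_lt_zero.2 hθ)
    · refine (ENNReal.continuous_rpow_const.tendsto _).comp (tendsto_const_nhds.add ?_)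
      simp only [hge]
      exact lintegral_tendsto_of_tendsto_of_monotone (fun n => (e n).measurable.aemeasurable)
        (ae_of_all _ hmono) (ae_of_all _ htend)
  have hR : Tendsto (fun n => ∫ x, Real.log (1 + g n x) ∂F) atTop
      (𝓝 (∫ x, Real.log (1 + f x) ∂F)) := by
    refine tendsto_integral_of_dominated_convergence _ (fun n => ?_) hlog
      (fun n => ae_of_all _ fun x => ?_) (ae_of_all _ fun x => ?_)
    · exact (Real.measurable_log.comp
        (measurable_const.add (g n).measurable)).aestronglyMeasurable
    · rw [Real.norm_of_nonneg (Real.log_nonneg (by linarith [hg0 n x]))]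
      exact Real.log_le_log (by linarith [hg0 n x]) (by linarith [hgle n x])
    · exact (tendsto_const_nhds.add (hgt x)).log (by linarith [hf0 x])
  refine tendsto_nhds_unique hL ?_
  simp only [fun n => hP.lintegral_rpow_simpleFunc hθ (g n) (hg0 n)]
  exact ENNReal.tendsto_ofReal ((Real.continuous_exp.tendsto _).comp (hR.const_mul _))

/-- For the indicator of a null set, Markov–Krein gives E[(1 + P(s))^(-θ)] = 1 with an integrand at
most 1, which forces P(s) = 0. Applied to the negative half-line, this makes the mean nonnegative.
-/
lemma ae_measure_eq_zero [IsProbabilityMeasure F] [IsProbabilityMeasure μ]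
    (hP : IsDirichletProcess θ F P μ) (hθ : 0 < θ) {s : Set ℝ} (hs : MeasurableSet s)
    (hFs : F s = 0) : ∀ᵐ ω ∂μ, P ω s = 0 := by
  have hf : ∀ x, ENNReal.ofReal (s.indicator (fun _ => (1 : ℝ)) x) = s.indicator 1 x := by
    intro x; by_cases hx : x ∈ s <;> simp [hx]
  have hlog0 : (fun x => Real.log (1 + s.indicator (fun _ => (1 : ℝ)) x)) =ᵐ[F] fun _ => 0 := by
    have : ∀ᵐ x ∂F, x ∉ s := measure_eq_zero_iff_ae_notMem.1 hFs
    filter_upwards [this] with x hx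
    simp [hx]
  have h := hP.lintegral_rpow hθ (f := s.indicator fun _ => 1) (measurable_const.indicator hs)
    (fun x => Set.indicator_nonneg (fun _ _ => zero_le_one) x)
    ((integrable_congr hlog0).2 (integrable_zero _ _ _))
  rw [integral_congr_ae hlog0] at h
  simp only [hf, lintegral_indicator_one hs, integral_zero, mul_zero, Real.exp_zero,
    ENNReal.ofReal_one] at h
  have hle : (fun ω => (1 + P ω s) ^ (-θ)) ≤ᵐ[μ] fun _ => (1 : ENNReal) :=
    ae_of_all _ fun ω => ENNReal.rpow_le_one_of_one_le_of_neg le_self_add (neg_lt_zero.2 hθ)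
  have h1 := ae_eq_of_ae_le_of_lintegral_le hle (by rw [h]; simp) aemeasurable_const
    (by rw [h]; simp)
  filter_upwards [h1] with ω hω
  have := hP.isProbabilityMeasure ω
  rw [ENNReal.rpow_neg, ENNReal.inv_eq_one] at hω
  by_contra hne
  have h2 : (1 : ENNReal) < 1 + P ω s := ENNReal.lt_add_right ENNReal.one_ne_top hne
  exact (ENNReal.one_lt_rpow h2 hθ).ne' hω

end IsDirichletProcess

lemma integrable_log_one_add_mul {F : Measure ℝ} [IsFiniteMeasure F] (hF0 : ∀ᵐ x ∂F, 0 ≤ x)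
    (hlog : Integrable (fun x => Real.log (1 + x)) F) {c : ℝ} (hc : 0 < c) :
    Integrable (fun x => Real.log (1 + c * x)) F := by
  have hm : Measurable fun x => Real.log (1 + c * x) :=
    Real.measurable_log.comp (by fun_prop)
  refine ((integrable_const (Real.log (1 + c))).add hlog).mono' hm.aestronglyMeasurable ?_
  filter_upwards [hF0] with x hx
  have h1 : 0 ≤ c * x := by positivity
  rw [Real.norm_of_nonneg (Real.log_nonneg (by linarith)), Pi.add_apply,
    ← Real.log_mul (by positivity) (by positivity)]
  exact Real.log_le_log (by linarith) (by nlinarith)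

namespace IsDirichletProcess

variable {Ω : Type*} [MeasurableSpace Ω] {θ : ℝ} {F : Measure ℝ} {P : Ω → Measure ℝ}
  {μ : Measure Ω}

lemma lintegral_rpow_abs [IsProbabilityMeasure F] [IsProbabilityMeasure μ]
    (hP : IsDirichletProcess θ F P μ) (hθ : 0 < θ) (hF0 : ∀ᵐ x ∂F, 0 ≤ x)
    (hlog : Integrable (fun x => Real.log (1 + x)) F) {c : ℝ} (hc : 0 < c) :
    ∫⁻ ω, (1 + ENNReal.ofReal c * ∫⁻ x, ENNReal.ofReal |x| ∂P ω) ^ (-θ) ∂μ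
      = ENNReal.ofReal (Real.exp (-θ * levyExponent F c)) := by
  have h0 : (fun x => Real.log (1 + c * x)) =ᵐ[F] fun x => Real.log (1 + c * |x|) := by
    filter_upwards [hF0] with x hx
    rw [abs_of_nonneg hx]
  have h := hP.lintegral_rpow hθ (f := fun x => c * |x|) (by fun_prop) (fun x => by positivity)
    ((integrable_congr h0).1 (integrable_log_one_add_mul hF0 hlog hc))
  rw [← integral_congr_ae h0] at h
  simpa only [levyExponent, ENNReal.ofReal_mul hc.le, lintegral_const_mul' _ _ ENNReal.ofReal_ne_top] using h

/-- The integrand (1 + cM)^(-θ) is at most 1 and vanishes where M = ∞, so P(M < ∞) ≥ exp(-θ ψ_F(c)),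
and the right side tends to 1 as c → 0. -/
lemma ae_lintegral_lt_top [IsProbabilityMeasure F] [IsProbabilityMeasure μ]
    (hP : IsDirichletProcess θ F P μ) (hθ : 0 < θ) (hF0 : ∀ᵐ x ∂F, 0 ≤ x)
    (hlog : Integrable (fun x => Real.log (1 + x)) F) :
    ∀ᵐ ω ∂μ, ∫⁻ x, ENNReal.ofReal |x| ∂P ω < ⊤ := by
  have hM : Measurable fun ω => ∫⁻ x, ENNReal.ofReal |x| ∂P ω :=
    hP.measurable_lintegral (by fun_prop)
  have hS : MeasurableSet {ω | ∫⁻ x, ENNReal.ofReal |x| ∂P ω < ⊤} :=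
    measurableSet_lt hM measurable_const
  have hle : ∀ c : ℝ, 0 < c → ENNReal.ofReal (Real.exp (-θ * levyExponent F c))
      ≤ μ {ω | ∫⁻ x, ENNReal.ofReal |x| ∂P ω < ⊤} := by
    intro c hc
    rw [← hP.lintegral_rpow_abs hθ hF0 hlog hc, ← lintegral_indicator_one hS]
    refine lintegral_mono fun ω => ?_
    by_cases hω : ∫⁻ x, ENNReal.ofReal |x| ∂P ω < ⊤
    · rw [Set.indicator_of_mem (by exact hω)]
      exact ENNReal.rpow_le_one_of_one_le_of_neg le_self_add (neg_lt_zero.2 hθ)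
    · rw [Set.indicator_of_notMem (by exact hω), not_lt_top_iff.1 hω,
        ENNReal.mul_top (by simpa using hc), add_top, ENNReal.top_rpow_of_neg (neg_lt_zero.2 hθ)]
  have hpsi : Tendsto (fun n : ℕ => levyExponent F (1 / ((n : ℝ) + 1))) atTop (𝓝 0) := by
    have hcn := tendsto_one_div_add_atTop_nhds_zero_nat (𝕜 := ℝ)
    have h := tendsto_integral_of_dominated_convergence (μ := F)
      (F := fun (n : ℕ) (x : ℝ) => Real.log (1 + 1 / ((n : ℝ) + 1) * x)) (f := fun _ => 0) _
      (fun n => (Real.measurable_log.comp (by fun_prop)).aestronglyMeasurable) hlog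
      (fun n => ?_) (ae_of_all _ fun x => ?_)
    · simpa [levyExponent] using h
    · filter_upwards [hF0] with x hx
      have h1 : 0 ≤ 1 / ((n : ℝ) + 1) * x := by positivity
      have h2 : 1 / ((n : ℝ) + 1) ≤ 1 := by
        rw [div_le_one (by positivity)]; linarith [n.cast_nonneg (α := ℝ)]
      rw [Real.norm_of_nonneg (Real.log_nonneg (by linarith))]
      exact Real.log_le_log (by linarith) (by nlinarith)
    · have h3 := (tendsto_const_nhds (x := (1 : ℝ))).add (hcn.mul_const x)
      simpa using h3.log (by simp)
  have h1 : Tendsto (fun n : ℕ => ENNReal.ofReal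
      (Real.exp (-θ * levyExponent F (1 / ((n : ℝ) + 1))))) atTop (𝓝 1) := by
    have := ENNReal.tendsto_ofReal ((Real.continuous_exp.tendsto _).comp (hpsi.const_mul (-θ)))
    simpa using this
  have h2 : 1 ≤ μ {ω | ∫⁻ x, ENNReal.ofReal |x| ∂P ω < ⊤} :=
    le_of_tendsto' h1 fun n => hle _ (by positivity)
  exact (mem_ae_iff_prob_eq_one hS).2 (le_antisymm prob_le_one h2)

lemma measurable_meanFunctional (hP : IsDirichletProcess θ F P μ) :
    Measurable (meanFunctional P) := by
  let κ : Kernel Ω ℝ := ⟨P, hP.measurable⟩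
  exact (StronglyMeasurable.integral_kernel (κ := κ) (f := fun x : ℝ => x)
    measurable_id.stronglyMeasurable).measurable

variable [IsProbabilityMeasure F] [IsProbabilityMeasure μ]

lemma ae_integrable (hP : IsDirichletProcess θ F P μ) (hθ : 0 < θ) (hF0 : ∀ᵐ x ∂F, 0 ≤ x)
    (hlog : Integrable (fun x => Real.log (1 + x)) F) :
    ∀ᵐ ω ∂μ, Integrable (fun x : ℝ => x) (P ω) := by
  filter_upwards [hP.ae_lintegral_lt_top hθ hF0 hlog] with ω hω
  refine ⟨measurable_id.aestronglyMeasurable, ?_⟩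
  simpa only [hasFiniteIntegral_iff_norm, Real.norm_eq_abs] using hω

lemma ae_ofReal_meanFunctional (hP : IsDirichletProcess θ F P μ) (hθ : 0 < θ)
    (hF0 : ∀ᵐ x ∂F, 0 ≤ x) (hlog : Integrable (fun x => Real.log (1 + x)) F) :
    ∀ᵐ ω ∂μ, 0 ≤ meanFunctional P ω ∧
      ENNReal.ofReal (meanFunctional P ω) = ∫⁻ x, ENNReal.ofReal |x| ∂P ω := by
  have hneg : F (Set.Iio 0) = 0 := by
    rw [measure_eq_zero_iff_ae_notMem]
    simpa using hF0
  filter_upwards [hP.ae_measure_eq_zero hθ measurableSet_Iio hneg,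
    hP.ae_integrable hθ hF0 hlog] with ω h1 h2
  have h3 : ∀ᵐ x ∂P ω, 0 ≤ x := by
    simpa using measure_eq_zero_iff_ae_notMem.1 h1
  refine ⟨integral_nonneg_of_ae h3, ?_⟩
  rw [meanFunctional, ofReal_integral_eq_lintegral_ofReal h2 h3]
  refine lintegral_congr_ae ?_
  filter_upwards [h3] with x hx
  rw [abs_of_nonneg hx]

/-- The generalized Stieltjes transform of a Dirichlet mean. -/
lemma lintegral_meanFunctional_rpow (hP : IsDirichletProcess θ F P μ) (hθ : 0 < θ)
    (hF0 : ∀ᵐ x ∂F, 0 ≤ x) (hlog : Integrable (fun x => Real.log (1 + x)) F)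
    {c : ℝ} (hc : 0 < c) :
    ∫⁻ ω, ENNReal.ofReal ((1 + c * meanFunctional P ω) ^ (-θ)) ∂μ
      = ENNReal.ofReal (Real.exp (-θ * levyExponent F c)) := by
  rw [← hP.lintegral_rpow_abs hθ hF0 hlog hc]
  refine lintegral_congr_ae ?_
  filter_upwards [hP.ae_ofReal_meanFunctional hθ hF0 hlog] with ω hω
  rw [← hω.2, ← ENNReal.ofReal_mul hc.le, ofReal_one_add_rpow (mul_nonneg hc.le hω.1)]

end IsDirichletProcess

/-- The substitution w = b(1 + z) / (1 + zb) maps (0, 1) onto itself and turns (1 + zb)⁻¹ times the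
beta density into (1 + z)^(-σ) times the beta density, whose integral is 1. This identity lowers the
order of the transform of M_σ from σ to one. -/
lemma lintegral_betaLaw_inv {σ z : ℝ} (hσ0 : 0 < σ) (hσ1 : σ ≤ 1) (hz : 0 ≤ z) :
    ∫⁻ b, ENNReal.ofReal ((1 + z * b)⁻¹) ∂betaLaw σ (1 - σ)
      = ENNReal.ofReal ((1 + z) ^ (-σ)) := by
  rcases hσ1.eq_or_lt with rfl | hlt
  · rw [betaLaw, if_pos (by norm_num), lintegral_dirac' _ (by fun_prop), mul_one,
      Real.rpow_neg_one]
  have hb0 : 0 < 1 - σ := by linarith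
  rw [betaLaw, if_neg hb0.ne']
  have hmb : Measurable (betaPDF σ (1 - σ)) := (measurable_betaPDFReal _ _).ennreal_ofReal
  have hone := lintegral_betaPDF_eq_one hσ0 hb0
  rw [lintegral_betaPDF] at hone
  have hpos : ∀ b ∈ Set.Ioo (0 : ℝ) 1, 0 < 1 + z * b := fun b hb => by
    have := mul_nonneg hz hb.1.le
    linarith
  have hderiv : ∀ b ∈ Set.Ioo (0 : ℝ) 1, HasDerivWithinAt (fun b => b * (1 + z) / (1 + z * b))
      ((1 + z) / (1 + z * b) ^ 2) (Set.Ioo 0 1) b := by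
    intro b hb
    have h1 : HasDerivAt (fun b => b * (1 + z)) (1 + z) b := by
      simpa using (hasDerivAt_id b).mul_const (1 + z)
    have h2 : HasDerivAt (fun b => 1 + z * b) z b := by
      simpa using ((hasDerivAt_id b).const_mul z).const_add 1
    have h3 := h1.div h2 (hpos b hb).ne'
    refine (h3.congr_deriv ?_).hasDerivWithinAt
    congr 1
    ring
  have hinj : Set.InjOn (fun b => b * (1 + z) / (1 + z * b)) (Set.Ioo (0 : ℝ) 1) := by
    intro b hb d hd h
    have h1 := hpos b hb
    have h2 := hpos d hd
    simp only at h
    rw [div_eq_div_iff h1.ne' h2.ne'] at h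
    have h3 : (1 + z) * (b - d) = 0 := by linarith
    rcases mul_eq_zero.1 h3 with h4 | h4 <;> linarith
  have himg : (fun b => b * (1 + z) / (1 + z * b)) '' Set.Ioo (0 : ℝ) 1 = Set.Ioo 0 1 := by
    ext w
    constructor
    · rintro ⟨b, hb, rfl⟩
      have h1 := hpos b hb
      refine ⟨by have := hb.1; positivity, ?_⟩
      simp only
      rw [div_lt_one h1]
      linarith [hb.2]
    · intro hw
      have h1 : 0 < 1 + z * (1 - w) := by
        have := mul_nonneg hz (sub_nonneg.2 hw.2.le)
        linarith
      have hw0 := hw.1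
      refine ⟨w / (1 + z * (1 - w)), ⟨by positivity, ?_⟩, ?_⟩
      · rw [div_lt_one h1]
        have := mul_nonneg hz (sub_nonneg.2 hw.2.le)
        linarith [hw.2]
      · have h2 : 1 + z * (w / (1 + z * (1 - w))) = (1 + z) / (1 + z * (1 - w)) := by
          field_simp
          ring
        simp only
        rw [h2]
        field_simp
  have h := lintegral_image_eq_lintegral_abs_deriv_mul measurableSet_Ioo hderiv hinj
    (fun w => ENNReal.ofReal (1 / beta σ (1 - σ) * w ^ (σ - 1) * (1 - w) ^ (1 - σ - 1)))
  rw [himg, hone] at h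
  rw [betaMeasure, lintegral_withDensity_eq_lintegral_mul _ hmb (by fun_prop)]
  have hsupp : ∀ b, (betaPDF σ (1 - σ) * fun b => ENNReal.ofReal ((1 + z * b)⁻¹)) b
      = (Set.Ioo (0 : ℝ) 1).indicator (fun b => ENNReal.ofReal ((1 + z) ^ (-σ)) *
        (ENNReal.ofReal |(1 + z) / (1 + z * b) ^ 2| *
          ENNReal.ofReal (1 / beta σ (1 - σ) * (b * (1 + z) / (1 + z * b)) ^ (σ - 1) *
            (1 - b * (1 + z) / (1 + z * b)) ^ (1 - σ - 1)))) b := by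
    intro b
    by_cases hb : b ∈ Set.Ioo (0 : ℝ) 1
    · have h1 := hpos b hb
      have hB := beta_pos hσ0 hb0
      have hb1 : 0 < 1 - b := sub_pos.2 hb.2
      have hbp := hb.1
      have h2 : 1 - b * (1 + z) / (1 + z * b) = (1 - b) / (1 + z * b) := by
        field_simp
        ring
      rw [Set.indicator_of_mem hb, Pi.mul_apply, betaPDF_of_pos_lt_one hb.1 hb.2, h2,
        ← ENNReal.ofReal_mul (by positivity), ← ENNReal.ofReal_mul (by positivity),
        ← ENNReal.ofReal_mul (by positivity), abs_of_pos (by positivity)]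
      congr 1
      have hz1 : 0 < 1 + z := by linarith
      rw [Real.div_rpow (by positivity) h1.le, Real.div_rpow hb1.le h1.le,
        Real.mul_rpow hbp.le hz1.le, Real.rpow_neg hz1.le, Real.rpow_sub_one hz1.ne',
        Real.rpow_sub_one h1.ne', show 1 - σ - 1 = -σ by ring, Real.rpow_neg h1.le]
      have h3 := (Real.rpow_pos_of_pos hz1 σ).ne'
      have h4 := (Real.rpow_pos_of_pos h1 σ).ne'
      field_simp
    · rw [Set.indicator_of_notMem hb, Pi.mul_apply]
      rcases not_and_or.1 hb with h1 | h1
      · rw [betaPDF_eq_zero_of_nonpos (not_lt.1 h1), zero_mul]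
      · rw [betaPDF_eq_zero_of_one_le (not_lt.1 h1), zero_mul]
  rw [lintegral_congr hsupp, lintegral_indicator measurableSet_Ioo,
    lintegral_const_mul' _ _ ENNReal.ofReal_ne_top, ← h, mul_one]

/-! ### Analytic continuation of the Stieltjes identity -/

/-- For x ≥ 0 the point -x lies on the cut, and |x + z| is its distance to z. Taking δ as half the
radius of a ball around w inside the slit plane gives the uniform bounds for differentiation under
the integral. -/
lemma exists_norm_add_lower_bound {w : ℂ} (hw : w ∈ Complex.slitPlane) :
    ∃ δ > 0, ∀ z ∈ Metric.ball w δ, ∀ x : ℝ, 0 ≤ x → z ∈ Complex.slitPlane ∧ δ ≤ ‖(x : ℂ) + z‖ := by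
  obtain ⟨ε, hε, hball⟩ := Metric.isOpen_iff.1 Complex.isOpen_slitPlane w hw
  refine ⟨ε / 2, by positivity, fun z hz x hx => ⟨hball ?_, ?_⟩⟩
  · exact Metric.ball_subset_ball (by linarith) hz
  · by_contra! hlt
    have h1 : (-(x : ℂ)) ∈ Metric.ball w ε := by
      rw [Metric.mem_ball, dist_eq_norm] at hz ⊢
      have h2 : -(x : ℂ) - w = (z - w) - ((x : ℂ) + z) := by ring
      rw [h2]
      exact (norm_sub_le _ _).trans_lt (by linarith)
    have h3 := hball h1
    rw [Complex.mem_slitPlane_iff] at h3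
    simp at h3
    linarith

lemma add_mem_slitPlane {w : ℂ} (hw : w ∈ Complex.slitPlane) {x : ℝ} (hx : 0 ≤ x) :
    (x : ℂ) + w ∈ Complex.slitPlane := by
  rw [Complex.mem_slitPlane_iff] at hw ⊢
  rcases hw with h | h
  · left; simp; linarith
  · right; simpa using h

lemma integrable_log_add {G : Measure ℝ} [IsFiniteMeasure G] (hG0 : ∀ᵐ x ∂G, 0 ≤ x)
    (hlog : Integrable (fun x => Real.log (1 + x)) G) {w : ℂ} (hw : w ∈ Complex.slitPlane) :
    Integrable (fun x : ℝ => Complex.log ((x : ℂ) + w)) G := by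
  obtain ⟨δ, hδ, hb⟩ := exists_norm_add_lower_bound hw
  have hm : Measurable fun x : ℝ => Complex.log ((x : ℂ) + w) :=
    Complex.measurable_log.comp (by fun_prop)
  refine ((integrable_const (|Real.log δ| + Real.log (1 + ‖w‖) + Real.pi)).add hlog).mono'
    hm.aestronglyMeasurable ?_
  filter_upwards [hG0] with x hx
  have h1 := (hb w (Metric.mem_ball_self hδ) x hx).2
  have h2 : ‖(x : ℂ) + w‖ ≤ (1 + ‖w‖) * (1 + x) := by
    refine (norm_add_le _ _).trans ?_
    rw [Complex.norm_real, Real.norm_of_nonneg hx]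
    nlinarith [norm_nonneg w]
  have h3 : |Real.log ‖(x : ℂ) + w‖| ≤ |Real.log δ| + (Real.log (1 + ‖w‖) + Real.log (1 + x)) := by
    rw [← Real.log_mul (by positivity) (by positivity)]
    have h4 := Real.log_le_log hδ h1
    have h5 := Real.log_le_log (hδ.trans_le h1) h2
    have h6 : 0 ≤ Real.log ((1 + ‖w‖) * (1 + x)) :=
      Real.log_nonneg (by nlinarith [norm_nonneg w])
    rw [abs_le]
    constructor <;> linarith [neg_abs_le (Real.log δ), abs_nonneg (Real.log δ)]
  refine (Complex.norm_le_abs_re_add_abs_im _).trans ?_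
  rw [Complex.log_re, Complex.log_im, Pi.add_apply]
  linarith [Complex.abs_arg_le_pi ((x : ℂ) + w)]

lemma integrable_inv_add {ν : Measure ℝ} [IsFiniteMeasure ν] (hν0 : ∀ᵐ x ∂ν, 0 ≤ x)
    {w : ℂ} (hw : w ∈ Complex.slitPlane) :
    Integrable (fun x : ℝ => ((x : ℂ) + w)⁻¹) ν := by
  obtain ⟨δ, hδ, hb⟩ := exists_norm_add_lower_bound hw
  have hm : Measurable fun x : ℝ => ((x : ℂ) + w)⁻¹ := by fun_prop
  refine (integrable_const δ⁻¹).mono' hm.aestronglyMeasurable ?_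
  filter_upwards [hν0] with x hx
  rw [norm_inv]
  exact inv_anti₀ hδ (hb w (Metric.mem_ball_self hδ) x hx).2

lemma differentiableOn_integral_log_add {G : Measure ℝ} [IsFiniteMeasure G]
    (hG0 : ∀ᵐ x ∂G, 0 ≤ x) (hlog : Integrable (fun x => Real.log (1 + x)) G) :
    DifferentiableOn ℂ (fun w : ℂ => ∫ x : ℝ, Complex.log ((x : ℂ) + w) ∂G) Complex.slitPlane := by
  intro w hw
  obtain ⟨δ, hδ, hb⟩ := exists_norm_add_lower_bound hw
  have h := hasDerivAt_integral_of_dominated_loc_of_deriv_le (μ := G)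
    (F := fun (w : ℂ) (x : ℝ) => Complex.log ((x : ℂ) + w))
    (F' := fun (w : ℂ) (x : ℝ) => ((x : ℂ) + w)⁻¹) (bound := fun _ => δ⁻¹)
    (Metric.ball_mem_nhds w hδ)
    (Eventually.of_forall fun z =>
      (Complex.measurable_log.comp (by fun_prop)).aestronglyMeasurable)
    (integrable_log_add hG0 hlog hw) (integrable_inv_add hG0 hw).aestronglyMeasurable
    (by
      filter_upwards [hG0] with x hx z hz
      rw [norm_inv]
      exact inv_anti₀ hδ (hb z hz x hx).2)
    (integrable_const _)
    (by
      filter_upwards [hG0] with x hx z hz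
      have h1 : HasDerivAt (fun z : ℂ => (x : ℂ) + z) 1 z := (hasDerivAt_id z).const_add _
      simpa using h1.clog (add_mem_slitPlane (hb z hz x hx).1 hx))
  exact h.2.differentiableAt.differentiableWithinAt

lemma differentiableOn_integral_inv_add {ν : Measure ℝ} [IsFiniteMeasure ν]
    (hν0 : ∀ᵐ x ∂ν, 0 ≤ x) :
    DifferentiableOn ℂ (fun w : ℂ => ∫ x : ℝ, ((x : ℂ) + w)⁻¹ ∂ν) Complex.slitPlane := by
  intro w hw
  obtain ⟨δ, hδ, hb⟩ := exists_norm_add_lower_bound hw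
  have h := hasDerivAt_integral_of_dominated_loc_of_deriv_le (μ := ν)
    (F := fun (w : ℂ) (x : ℝ) => ((x : ℂ) + w)⁻¹)
    (F' := fun (w : ℂ) (x : ℝ) => -1 / ((x : ℂ) + w) ^ 2) (bound := fun _ => 1 / δ ^ 2)
    (Metric.ball_mem_nhds w hδ)
    (Eventually.of_forall fun z =>
      (show Measurable fun x : ℝ => ((x : ℂ) + z)⁻¹ by fun_prop).aestronglyMeasurable)
    (integrable_inv_add hν0 hw)
    (show Measurable fun x : ℝ => -1 / ((x : ℂ) + w) ^ 2 by fun_prop).aestronglyMeasurable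
    (by
      filter_upwards [hν0] with x hx z hz
      rw [norm_div, norm_neg, norm_one, norm_pow]
      exact one_div_le_one_div_of_le (by positivity)
        (pow_le_pow_left₀ hδ.le (hb z hz x hx).2 2))
    (integrable_const _)
    (by
      filter_upwards [hν0] with x hx z hz
      have h1 : HasDerivAt (fun z : ℂ => (x : ℂ) + z) 1 z := (hasDerivAt_id z).const_add _
      exact h1.inv (Complex.slitPlane_ne_zero (add_mem_slitPlane (hb z hz x hx).1 hx)))
  exact h.2.differentiableAt.differentiableWithinAt

/-- `ν` has Stieltjes transform `exp (-∫ log (x + w) G(dx))` on the positive half-line. -/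
def HasMarkovTransform (ν G : Measure ℝ) : Prop :=
  ∀ w : ℝ, 0 < w → ∫ x, (x + w)⁻¹ ∂ν = Real.exp (-∫ x, Real.log (x + w) ∂G)

/-- Both sides are holomorphic on the connected slit plane and agree on the positive reals, which
accumulate at 1. -/
lemma HasMarkovTransform.integral_inv_add {ν G : Measure ℝ} [IsFiniteMeasure ν]
    [IsFiniteMeasure G] (h : HasMarkovTransform ν G) (hν0 : ∀ᵐ x ∂ν, 0 ≤ x)
    (hG0 : ∀ᵐ x ∂G, 0 ≤ x) (hlog : Integrable (fun x => Real.log (1 + x)) G)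
    {w : ℂ} (hw : w ∈ Complex.slitPlane) :
    ∫ x : ℝ, ((x : ℂ) + w)⁻¹ ∂ν = Complex.exp (-∫ x : ℝ, Complex.log ((x : ℂ) + w) ∂G) := by
  have hreal : ∀ r : ℝ, 0 < r → ∫ x : ℝ, ((x : ℂ) + (r : ℂ))⁻¹ ∂ν
      = Complex.exp (-∫ x : ℝ, Complex.log ((x : ℂ) + (r : ℂ)) ∂G) := by
    intro r hr
    have h1 := h r hr
    have h2 : ∫ x : ℝ, ((x : ℂ) + (r : ℂ))⁻¹ ∂ν = ((∫ x, (x + r)⁻¹ ∂ν : ℝ) : ℂ) := by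
      rw [← integral_complex_ofReal]
      simp
    have h3 : ∫ x : ℝ, Complex.log ((x : ℂ) + (r : ℂ)) ∂G
        = ((∫ x, Real.log (x + r) ∂G : ℝ) : ℂ) := by
      rw [← integral_complex_ofReal]
      refine integral_congr_ae ?_
      filter_upwards [hG0] with x hx
      rw [Complex.ofReal_log (by linarith), Complex.ofReal_add]
    rw [h2, h3, h1]
    push_cast
    rfl
  refine AnalyticOnNhd.eqOn_of_preconnected_of_frequently_eq (z₀ := 1) (U := Complex.slitPlane)
    (f := fun w : ℂ => ∫ x : ℝ, ((x : ℂ) + w)⁻¹ ∂ν)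
    (g := fun w : ℂ => Complex.exp (-∫ x : ℝ, Complex.log ((x : ℂ) + w) ∂G))
    ((differentiableOn_integral_inv_add hν0).analyticOnNhd Complex.isOpen_slitPlane)
    (((differentiableOn_integral_log_add hG0 hlog).neg.cexp).analyticOnNhd
      Complex.isOpen_slitPlane)
    (Complex.starConvex_one_slitPlane.isPathConnected Complex.one_mem_slitPlane).isConnected.isPreconnected
    Complex.one_mem_slitPlane ?_ hw
  have htend : Tendsto (fun n : ℕ => ((1 + 1 / ((n : ℝ) + 1) : ℝ) : ℂ)) atTop (𝓝[≠] 1) := by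
    refine tendsto_nhdsWithin_iff.2 ⟨?_, Eventually.of_forall fun n => ?_⟩
    · have := (tendsto_const_nhds (x := (1 : ℝ))).add
        (tendsto_one_div_add_atTop_nhds_zero_nat (𝕜 := ℝ))
      rw [add_zero] at this
      exact (Complex.continuous_ofReal.tendsto 1).comp this
    · have : (0 : ℝ) < 1 / ((n : ℝ) + 1) := by positivity
      simp only [Set.mem_compl_iff, Set.mem_singleton_iff]
      exact_mod_cast (by linarith : (1 : ℝ) < 1 + 1 / ((n : ℝ) + 1)).ne'
  exact htend.frequently (Eventually.of_forall fun n => hreal _ (by positivity)).frequently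

lemma neg_sub_mul_I_mem_slitPlane {ε : ℝ} (hε : 0 < ε) (t : ℝ) :
    (-(t : ℂ) - ε * Complex.I) ∈ Complex.slitPlane := by
  rw [Complex.mem_slitPlane_iff]
  right
  simp [hε.ne']

/-- The Poisson integral of `ν` in terms of the logarithmic potential of `G`. -/
lemma HasMarkovTransform.integral_poisson {ν G : Measure ℝ} [IsFiniteMeasure ν]
    [IsFiniteMeasure G] (h : HasMarkovTransform ν G) (hν0 : ∀ᵐ x ∂ν, 0 ≤ x)
    (hG0 : ∀ᵐ x ∂G, 0 ≤ x) (hlog : Integrable (fun x => Real.log (1 + x)) G)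
    {ε : ℝ} (hε : 0 < ε) (t : ℝ) :
    ∫ x, ε / ((x - t) ^ 2 + ε ^ 2) ∂ν
      = Real.exp (-∫ x : ℝ, Real.log ‖((x - t : ℝ) : ℂ) - ε * Complex.I‖ ∂G)
        * Real.sin (-∫ x : ℝ, Complex.arg (((x - t : ℝ) : ℂ) - ε * Complex.I) ∂G) := by
  -- At w = -t - iε, the imaginary part of (x + w)⁻¹ is the Poisson kernel.
  have hw := neg_sub_mul_I_mem_slitPlane hε t
  have h1 := h.integral_inv_add hν0 hG0 hlog hw
  have e1 : ∀ x : ℝ, (x : ℂ) + (-(t : ℂ) - ε * Complex.I)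
      = ((x - t : ℝ) : ℂ) - ε * Complex.I := by intro x; push_cast; ring
  have i1 := integrable_inv_add hν0 hw
  have i2 := integrable_log_add hG0 hlog hw
  simp only [e1] at h1 i1 i2
  have h2 := congrArg Complex.im h1
  rw [Complex.exp_im, Complex.neg_re, Complex.neg_im] at h2
  have hre : (∫ x : ℝ, Complex.log (((x - t : ℝ) : ℂ) - ε * Complex.I) ∂G).re
      = ∫ x : ℝ, Real.log ‖((x - t : ℝ) : ℂ) - ε * Complex.I‖ ∂G := by
    rw [← RCLike.re_to_complex, ← integral_re i2]
    simp only [RCLike.re_to_complex, Complex.log_re]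
  have him : (∫ x : ℝ, Complex.log (((x - t : ℝ) : ℂ) - ε * Complex.I) ∂G).im
      = ∫ x : ℝ, Complex.arg (((x - t : ℝ) : ℂ) - ε * Complex.I) ∂G := by
    rw [← RCLike.im_to_complex, ← integral_im i2]
    simp only [RCLike.im_to_complex, Complex.log_im]
  have hinv : (∫ x : ℝ, (((x - t : ℝ) : ℂ) - ε * Complex.I)⁻¹ ∂ν).im
      = ∫ x, ε / ((x - t) ^ 2 + ε ^ 2) ∂ν := by
    rw [← RCLike.im_to_complex, ← integral_im i1]
    refine integral_congr_ae (ae_of_all _ fun x => ?_)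
    simp [Complex.normSq_apply, sq]
  rw [hre, him, hinv] at h2
  exact h2

/-! ### The logarithmic potential -/

/-- Since `Real.log 0 = 0`, the indicator in the definition is redundant. -/
lemma logPotential_eq (G : Measure ℝ) (t : ℝ) :
    logPotential G t = ∫ x, Real.log |t - x| ∂G := by
  refine integral_congr_ae (ae_of_all _ fun x => ?_)
  by_cases h : t = x
  · simp [h]
  · simp [h]

/-- The kernel `|u| ^ (-p)` cut off at `|u| = 1`. -/
noncomputable def powKernel (p u : ℝ) : ℝ := if |u| ≤ 1 then Real.exp (-p * Real.log |u|) else 0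

lemma powKernel_nonneg (p u : ℝ) : 0 ≤ powKernel p u := by
  unfold powKernel
  split_ifs <;> positivity

lemma integrable_powKernel {p : ℝ} (hp : p < 1) : Integrable (powKernel p) := by
  have h1 : IntegrableOn (fun x : ℝ => x ^ (-p)) (Set.Ioc 0 1) :=
    (intervalIntegral.intervalIntegrable_rpow' (a := 0) (b := 1)
      (by linarith : -1 < -p)).1
  have h2 : Integrable ((Set.Ioc (0 : ℝ) 1).indicator fun x => x ^ (-p)) :=
    (integrable_indicator_iff measurableSet_Ioc).2 h1
  refine (h2.add h2.comp_neg).congr ?_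
  have h0 : ∀ᵐ u : ℝ, u ≠ 0 := compl_mem_ae_iff.2 (measure_singleton 0)
  filter_upwards [h0] with u hu
  rcases lt_or_gt_of_ne hu with h | h
  · have e1 : u ∉ Set.Ioc (0 : ℝ) 1 := fun h' => h.not_gt h'.1
    rw [Pi.add_apply, Set.indicator_of_notMem e1, zero_add, powKernel, abs_of_neg h]
    by_cases hl : -u ≤ 1
    · rw [if_pos hl, Set.indicator_of_mem (by exact ⟨neg_pos.2 h, hl⟩),
        Real.rpow_def_of_pos (neg_pos.2 h), mul_comm]
    · rw [if_neg hl, Set.indicator_of_notMem fun h' => hl h'.2]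
  · have e1 : -u ∉ Set.Ioc (0 : ℝ) 1 := fun h' => by linarith [h'.1]
    rw [Pi.add_apply, Set.indicator_of_notMem e1, add_zero, powKernel, abs_of_pos h]
    by_cases hl : u ≤ 1
    · rw [if_pos hl, Set.indicator_of_mem (by exact ⟨h, hl⟩), Real.rpow_def_of_pos h, mul_comm]
    · rw [if_neg hl, Set.indicator_of_notMem fun h' => hl h'.2]

/-- Joint integrability makes, by Fubini, x ↦ `powKernel p (t - x)` integrable against G for almost
every t, with integral locally integrable in t. -/
lemma integrable_powKernel_sub (G : Measure ℝ) [IsFiniteMeasure G] {p : ℝ} (hp : p < 1) :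
    Integrable (fun q : ℝ × ℝ => powKernel p (q.1 - q.2)) (volume.prod G) := by
  have := Integrable.convolution_integrand (ContinuousLinearMap.mul ℝ ℝ)
    (integrable_const (1 : ℝ) (μ := G)) (integrable_powKernel hp)
  simpa using this

lemma abs_log_abs_le (u : ℝ) :
    abs (Real.log |u|) ≤ Real.log (1 + |u|) + 2 * powKernel (1 / 2) u := by
  have h0 := abs_nonneg u
  unfold powKernel
  split_ifs with h
  · have h1 : Real.log |u| ≤ 0 := Real.log_nonpos h0 h
    have h2 : 0 ≤ Real.log (1 + |u|) := Real.log_nonneg (by linarith)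
    have h3 := Real.add_one_le_exp (-(1 / 2) * Real.log |u|)
    rw [abs_of_nonpos h1]
    linarith
  · rw [not_le] at h
    rw [abs_of_nonneg (Real.log_nonneg h.le)]
    linarith [Real.log_le_log (by linarith) (by linarith : |u| ≤ 1 + |u|)]

lemma ae_integrable_log_abs_sub {G : Measure ℝ} [IsFiniteMeasure G] (hG0 : ∀ᵐ x ∂G, 0 ≤ x)
    (hlog : Integrable (fun x => Real.log (1 + x)) G) :
    ∀ᵐ t : ℝ, Integrable (fun x => Real.log |t - x|) G := by
  filter_upwards [(integrable_powKernel_sub G (p := 1 / 2) (by norm_num)).prod_right_ae] with t ht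
  have hm : Measurable fun x => Real.log |t - x| := Real.measurable_log.comp (by fun_prop)
  refine (((integrable_const (Real.log (1 + |t|))).add hlog).add (ht.const_mul 2)).mono'
    hm.aestronglyMeasurable ?_
  filter_upwards [hG0] with x hx
  refine (abs_log_abs_le (t - x)).trans ?_
  simp only [Pi.add_apply]
  refine add_le_add_left ?_ _
  rw [← Real.log_mul (by positivity) (by positivity)]
  refine Real.log_le_log (by positivity) ?_
  have := abs_sub t x
  rw [abs_of_nonneg hx] at this
  nlinarith [abs_nonneg t]

lemma ae_measure_singleton_eq_zero (G : Measure ℝ) [SFinite G] : ∀ᵐ t : ℝ, G {t} = 0 := by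
  have h : {t : ℝ | 0 < G {t}}.Countable :=
    Measure.countable_meas_pos_of_disjoint_iUnion (μ := G) (As := fun t : ℝ => {t})
      (fun t => measurableSet_singleton t) (fun s t hst => by simpa using hst)
  filter_upwards [h.ae_notMem volume] with t ht
  simpa using ht

lemma exists_closedBall_measure_lt_one {G : Measure ℝ} [IsFiniteMeasure G] (t : ℝ)
    (ht : G {t} < 1) : ∃ r > 0, r ≤ 1 / 4 ∧ G (Metric.closedBall t (2 * r)) < 1 := by
  have h1 := tendsto_measure_cthickening_of_isClosed (μ := G) (s := {t})
    ⟨1, one_pos, measure_ne_top _ _⟩ isClosed_singleton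
  have h2 : ∀ᶠ r in 𝓝 (0 : ℝ), G (Metric.cthickening r {t}) < 1 := h1.eventually (gt_mem_nhds ht)
  obtain ⟨ε, hε, hball⟩ := Metric.eventually_nhds_iff.1 h2
  refine ⟨min (ε / 4) (1 / 4), by positivity, min_le_right _ _, ?_⟩
  have h3 := min_le_left (ε / 4) (1 / 4 : ℝ)
  have h4 : 0 < min (ε / 4) (1 / 4 : ℝ) := by positivity
  have h5 := hball (y := 2 * min (ε / 4) (1 / 4 : ℝ)) (by
    rw [Real.dist_eq, sub_zero, abs_of_pos (by positivity)]
    linarith)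
  rwa [Metric.cthickening_singleton _ (by positivity)] at h5

lemma stronglyMeasurable_integral_log_abs_sub (G : Measure ℝ) [SFinite G] :
    StronglyMeasurable fun t => ∫ x, Real.log |t - x| ∂G := by
  have : Measurable fun q : ℝ × ℝ => Real.log |q.1 - q.2| :=
    Real.measurable_log.comp (by fun_prop)
  exact this.stronglyMeasurable.integral_prod_right

/-- The exponential of minus the logarithmic potential of a law without unit atoms is locally
integrable. -/
lemma locallyIntegrable_exp_neg_logPotential {G : Measure ℝ} [IsProbabilityMeasure G]
    (hG0 : ∀ᵐ x ∂G, 0 ≤ x) (hlog : Integrable (fun x => Real.log (1 + x)) G)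
    (hatom : ∀ a, G {a} < 1) :
    LocallyIntegrable fun t => Real.exp (-∫ x, Real.log |t - x| ∂G) := by
  intro t₀
  obtain ⟨r, hr0, hr1, hI⟩ := exists_closedBall_measure_lt_one t₀ (hatom t₀)
  set I := Metric.closedBall t₀ (2 * r)
  have hIm : MeasurableSet I := measurableSet_closedBall
  set m := G.real I
  have hm1 : m < 1 := (ENNReal.toReal_lt_toReal (measure_ne_top _ _) ENNReal.one_ne_top).2 hI
  have hm0 : 0 ≤ m := measureReal_nonneg
  have hK := integrable_powKernel_sub G hm1
  refine ⟨Metric.ball t₀ r, Metric.ball_mem_nhds _ hr0, ?_⟩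
  have hbound : Integrable (fun t => r⁻¹ * (1 + m⁻¹ * ∫ x, powKernel m (t - x) ∂G))
      (volume.restrict (Metric.ball t₀ r)) :=
    ((integrableOn_const measure_ball_lt_top.ne).add
      ((hK.integral_prod_left).const_mul m⁻¹).integrableOn).const_mul _
  refine hbound.mono' (Real.measurable_exp.comp
    (stronglyMeasurable_integral_log_abs_sub G).measurable.neg).aestronglyMeasurable ?_
  refine (ae_restrict_iff' measurableSet_ball).2 ?_
  filter_upwards [ae_integrable_log_abs_sub hG0 hlog, hK.prod_right_ae] with t ht hKt htb
  rw [Real.norm_of_nonneg (Real.exp_pos _).le]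
  rw [Metric.mem_ball, Real.dist_eq] at htb
  have hKi : 0 ≤ ∫ x, powKernel m (t - x) ∂G := integral_nonneg fun x => powKernel_nonneg _ _
  -- For t within r of t₀, points outside the ball of radius 2r are at distance at least r from t.
  -- As log r ≤ 0, replacing the mass of the complement by 1 keeps the bound.
  have hout : Real.log r ≤ ∫ x in Iᶜ, Real.log |t - x| ∂G := by
    have h1 : ∫ x in Iᶜ, Real.log r ∂G ≤ ∫ x in Iᶜ, Real.log |t - x| ∂G := by
      refine setIntegral_mono_on (integrable_const _) ht.integrableOn hIm.compl fun x hx => ?_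
      refine Real.log_le_log hr0 ?_
      simp only [I, Set.mem_compl_iff, Metric.mem_closedBall, Real.dist_eq, not_le] at hx
      have h2 : |x - t₀| ≤ |t - x| + |t - t₀| := by
        rw [abs_sub_comm t x]
        exact abs_sub_le x t t₀
      linarith
    rw [setIntegral_const, smul_eq_mul] at h1
    have h3 : Real.log r ≤ 0 := Real.log_nonpos hr0.le (by linarith)
    have h4 : G.real Iᶜ ≤ 1 := measureReal_le_one
    nlinarith
  have hin : Real.exp (-∫ x in I, Real.log |t - x| ∂G)
      ≤ 1 + m⁻¹ * ∫ x, powKernel m (t - x) ∂G := by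
    rcases hm0.eq_or_lt with h0 | h0
    · have h1 : G I = 0 := by
        simpa [m, measureReal_def, ENNReal.toReal_eq_zero_iff] using h0.symm
      rw [Measure.restrict_eq_zero.2 h1, integral_zero_measure, neg_zero, Real.exp_zero]
      have : 0 ≤ m⁻¹ * ∫ x, powKernel m (t - x) ∂G := by positivity
      linarith
    · have hle : ∀ x ∈ I, Real.exp (-m * Real.log |t - x|) = powKernel m (t - x) := by
        intro x hx
        rw [powKernel, if_pos]
        simp only [I, Metric.mem_closedBall, Real.dist_eq] at hx
        have h2 : |t - x| ≤ |t - t₀| + |x - t₀| := by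
          rw [abs_sub_comm x t₀]
          exact abs_sub_le t t₀ x
        linarith
      -- Jensen for the normalised restriction of G to I: -∫_I log |t - x| dG is the average of -m
      -- log |t - x|.
      have h1 := convexOn_exp.map_set_average_le (μ := G) (t := I)
        (f := fun x => -m * Real.log |t - x|) Real.continuous_exp.continuousOn isClosed_univ
        (fun h => by simp [m, measureReal_def, h] at h0) (measure_ne_top _ _) (by simp)
        (ht.const_mul _).integrableOn
        ((hKt.integrableOn (s := I)).congr_fun (fun x hx => (hle x hx).symm) hIm)
      rw [setAverage_eq, setAverage_eq, integral_const_mul, smul_eq_mul, smul_eq_mul,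
        ← mul_assoc] at h1
      have h2 : (G.real I)⁻¹ * -m = -1 := by
        change m⁻¹ * -m = -1
        field_simp
      rw [h2, neg_one_mul, setIntegral_congr_fun hIm hle] at h1
      refine h1.trans ?_
      have h3 : ∫ x in I, powKernel m (t - x) ∂G ≤ ∫ x, powKernel m (t - x) ∂G :=
        setIntegral_le_integral hKt (ae_of_all _ fun x => powKernel_nonneg _ _)
      have h4 : m⁻¹ * ∫ x in I, powKernel m (t - x) ∂G ≤ m⁻¹ * ∫ x, powKernel m (t - x) ∂G :=
        mul_le_mul_of_nonneg_left h3 (inv_nonneg.2 hm0)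
      change m⁻¹ * _ ≤ _
      linarith
  rw [← integral_add_compl hIm ht, neg_add, Real.exp_add, mul_comm]
  refine mul_le_mul ?_ hin (Real.exp_pos _).le (inv_nonneg.2 hr0.le)
  rw [← Real.exp_log (inv_pos.2 hr0), Real.log_inv]
  exact Real.exp_le_exp.2 (neg_le_neg hout)

/-! ### Inversion of the Stieltjes transform -/

/-- The Cifarelli–Regazzini density attached to the law `G`. -/
noncomputable def cifarelliDensity (G : Measure ℝ) (t : ℝ) : ℝ :=
  Real.pi⁻¹ * (Real.exp (-logPotential G t) * Real.sin (Real.pi * cdf G t))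

/-- The Cifarelli–Regazzini density evaluated at height `ε` above the real axis. -/
noncomputable def smoothedDensity (G : Measure ℝ) (ε t : ℝ) : ℝ :=
  Real.pi⁻¹ * (Real.exp (-∫ x : ℝ, Real.log ‖((x - t : ℝ) : ℂ) - ε * Complex.I‖ ∂G)
    * Real.sin (-∫ x : ℝ, Complex.arg (((x - t : ℝ) : ℂ) - ε * Complex.I) ∂G))

lemma norm_sub_mul_I (u ε : ℝ) : ‖(u : ℂ) - ε * Complex.I‖ = Real.sqrt (u ^ 2 + ε ^ 2) := by
  rw [Complex.norm_def, Complex.normSq_apply]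
  congr 1
  simp [sq]

lemma integrable_log_norm_sub_mul_I {G : Measure ℝ} [IsFiniteMeasure G]
    (hG0 : ∀ᵐ x ∂G, 0 ≤ x) (hlog : Integrable (fun x => Real.log (1 + x)) G)
    {ε : ℝ} (hε : 0 < ε) (t : ℝ) :
    Integrable (fun x : ℝ => Real.log ‖((x - t : ℝ) : ℂ) - ε * Complex.I‖) G := by
  have h := (integrable_log_add hG0 hlog (neg_sub_mul_I_mem_slitPlane hε t)).re
  refine h.congr (ae_of_all _ fun x => ?_)
  simp only [RCLike.re_to_complex, Complex.log_re]
  congr 2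
  push_cast
  ring

lemma log_abs_le_log_norm {t x : ℝ} (hx : x ≠ t) (ε : ℝ) :
    Real.log |t - x| ≤ Real.log ‖((x - t : ℝ) : ℂ) - ε * Complex.I‖ := by
  refine Real.log_le_log (abs_pos.2 (sub_ne_zero.2 hx.symm)) ?_
  rw [norm_sub_mul_I, abs_sub_comm]
  exact Real.abs_le_sqrt (by nlinarith [sq_nonneg ε])

lemma ae_ne_of_measure_singleton {G : Measure ℝ} {t : ℝ} (ht : G {t} = 0) :
    ∀ᵐ x ∂G, x ≠ t := by
  simpa using measure_eq_zero_iff_ae_notMem.1 ht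

/-- Moving off the real axis only increases the modulus, hence the logarithmic integral. The
resulting bound does not depend on ε. -/
lemma abs_smoothedDensity_le {G : Measure ℝ} [IsFiniteMeasure G]
    (hG0 : ∀ᵐ x ∂G, 0 ≤ x) (hlog : Integrable (fun x => Real.log (1 + x)) G)
    {ε t : ℝ} (hε : 0 < ε) (ht : G {t} = 0) (hti : Integrable (fun x => Real.log |t - x|) G) :
    |smoothedDensity G ε t| ≤ Real.exp (-∫ x, Real.log |t - x| ∂G) := by
  have h1 : ∫ x, Real.log |t - x| ∂G
      ≤ ∫ x : ℝ, Real.log ‖((x - t : ℝ) : ℂ) - ε * Complex.I‖ ∂G := by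
    refine integral_mono_ae hti (integrable_log_norm_sub_mul_I hG0 hlog hε t) ?_
    filter_upwards [ae_ne_of_measure_singleton ht] with x hx
    exact log_abs_le_log_norm hx ε
  rw [smoothedDensity, abs_mul, abs_mul, abs_of_pos (inv_pos.2 Real.pi_pos), Real.abs_exp]
  have h2 : Real.pi⁻¹ ≤ 1 := inv_le_one_of_one_le₀ (by linarith [Real.pi_gt_three])
  have h3 := Real.exp_le_exp.2 (neg_le_neg h1)
  have h4 := mul_le_mul h3 (Real.abs_sin_le_one
    (-∫ x : ℝ, Complex.arg (((x - t : ℝ) : ℂ) - ε * Complex.I) ∂G)) (abs_nonneg _)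
    (Real.exp_pos _).le
  rw [mul_one] at h4
  refine (mul_le_mul h2 h4 (by positivity) zero_le_one).trans ?_
  rw [one_mul]

lemma tendsto_smoothedDensity {G : Measure ℝ} [IsProbabilityMeasure G]
    (hG0 : ∀ᵐ x ∂G, 0 ≤ x) (hlog : Integrable (fun x => Real.log (1 + x)) G)
    {t : ℝ} (ht : G {t} = 0) (hti : Integrable (fun x => Real.log |t - x|) G)
    {ε : ℕ → ℝ} (hε0 : ∀ n, 0 < ε n) (hε1 : ∀ n, ε n ≤ 1) (hε : Tendsto ε atTop (𝓝 0)) :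
    Tendsto (fun n => smoothedDensity G (ε n) t) atTop (𝓝 (cifarelliDensity G t)) := by
  have hne := ae_ne_of_measure_singleton ht
  have hz : ∀ u : ℝ, Tendsto (fun n => (u : ℂ) - ε n * Complex.I) atTop (𝓝 (u : ℂ)) := by
    intro u
    have h1 : Tendsto (fun n => (ε n : ℂ)) atTop (𝓝 ((0 : ℝ) : ℂ)) :=
      (Complex.continuous_ofReal.tendsto 0).comp hε
    have h2 := (tendsto_const_nhds (x := (u : ℂ))).sub (h1.mul_const Complex.I)
    simpa using h2
  have hL : Tendsto (fun n => ∫ x : ℝ, Real.log ‖((x - t : ℝ) : ℂ) - ε n * Complex.I‖ ∂G) atTop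
      (𝓝 (∫ x, Real.log |t - x| ∂G)) := by
    -- For 0 < ε ≤ 1 the integrand lies between its values at heights 0 and 1, both integrable.
    refine tendsto_integral_of_dominated_convergence _
      (fun n => (integrable_log_norm_sub_mul_I hG0 hlog (hε0 n) t).aestronglyMeasurable)
      (hti.abs.add (integrable_log_norm_sub_mul_I hG0 hlog one_pos t).abs) (fun n => ?_) ?_
    · filter_upwards [hne] with x hx
      have h1 := log_abs_le_log_norm hx (ε n)
      have h2 : Real.log ‖((x - t : ℝ) : ℂ) - ε n * Complex.I‖
          ≤ Real.log ‖((x - t : ℝ) : ℂ) - (1 : ℝ) * Complex.I‖ := by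
        have h3 : (0 : ℝ) < (x - t) ^ 2 := by
          have := sub_ne_zero.2 hx
          positivity
        have h4 := hε0 n
        rw [norm_sub_mul_I, norm_sub_mul_I]
        refine Real.log_le_log (Real.sqrt_pos.2 (by positivity)) (Real.sqrt_le_sqrt ?_)
        nlinarith [hε1 n]
      rw [Real.norm_eq_abs, Pi.add_apply, abs_le]
      constructor
      · linarith [neg_abs_le (Real.log |t - x|),
          abs_nonneg (Real.log ‖((x - t : ℝ) : ℂ) - (1 : ℝ) * Complex.I‖)]
      · linarith [le_abs_self (Real.log ‖((x - t : ℝ) : ℂ) - (1 : ℝ) * Complex.I‖),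
          abs_nonneg (Real.log |t - x|)]
    · filter_upwards [hne] with x hx
      have h1 := (hz (x - t)).norm.log
        (norm_ne_zero_iff.2 (Complex.ofReal_ne_zero.2 (sub_ne_zero.2 hx)))
      rwa [Complex.norm_real, Real.norm_eq_abs, abs_sub_comm] at h1
  -- Approaching the real axis from below, the argument tends to -π on the negative axis and to 0 on
  -- the positive axis.
  have hA : Tendsto (fun n => ∫ x : ℝ, Complex.arg (((x - t : ℝ) : ℂ) - ε n * Complex.I) ∂G) atTop
      (𝓝 (∫ x, (Set.Iio t).indicator (fun _ => -Real.pi) x ∂G)) := by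
    refine tendsto_integral_of_dominated_convergence (fun _ => Real.pi)
      (fun n => (Complex.measurable_arg.comp (by fun_prop)).aestronglyMeasurable)
      (integrable_const _) (fun n => ae_of_all _ fun x => Complex.abs_arg_le_pi _) ?_
    filter_upwards [hne] with x hx
    rcases lt_or_gt_of_ne hx with h | h
    · rw [Set.indicator_of_mem (by exact h)]
      refine (Complex.tendsto_arg_nhdsWithin_im_neg_of_re_neg_of_im_zero
        (z := ((x - t : ℝ) : ℂ)) (by simpa using h) (Complex.ofReal_im _)).comp ?_
      refine tendsto_nhdsWithin_iff.2 ⟨hz _, Eventually.of_forall fun n => ?_⟩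
      simpa using hε0 n
    · rw [Set.indicator_of_notMem (by simpa using h.le)]
      have h1 : ((x - t : ℝ) : ℂ) ∈ Complex.slitPlane := by
        rw [Complex.ofReal_mem_slitPlane]
        exact sub_pos.2 h
      have h2 := (Complex.continuousAt_arg h1).tendsto.comp (hz (x - t))
      rwa [Complex.arg_ofReal_of_nonneg (sub_pos.2 h).le] at h2
  have hcdf : ∫ x, (Set.Iio t).indicator (fun _ => -Real.pi) x ∂G = -(Real.pi * cdf G t) := by
    rw [integral_indicator_const _ measurableSet_Iio, cdf_eq_real, smul_eq_mul]
    have : G.real (Set.Iic t) = G.real (Set.Iio t) := by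
      refine measureReal_congr ?_
      filter_upwards [hne] with x hx
      exact propext ⟨fun h => lt_of_le_of_ne h hx, fun h => le_of_lt h⟩
    rw [this]
    ring
  rw [hcdf] at hA
  have h1 := (((Real.continuous_exp.tendsto _).comp hL.neg).mul
    ((Real.continuous_sin.tendsto _).comp hA.neg)).const_mul Real.pi⁻¹
  rw [neg_neg, ← logPotential_eq] at h1
  exact h1

lemma integral_mul_poisson_eq (φ : ℝ → ℝ) {ε : ℝ} (hε : 0 < ε) (x : ℝ) :
    ∫ t, φ t * (ε / ((x - t) ^ 2 + ε ^ 2)) = ∫ s, φ (x + ε * s) * (1 + s ^ 2)⁻¹ := by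
  rw [← integral_add_left_eq_self (fun t => φ t * (ε / ((x - t) ^ 2 + ε ^ 2))) x]
  have h := Measure.integral_comp_mul_left
    (fun u => φ (x + u) * (ε / ((x - (x + u)) ^ 2 + ε ^ 2))) ε
  rw [abs_of_pos (inv_pos.2 hε), smul_eq_mul, eq_comm, inv_mul_eq_iff_eq_mul₀ hε.ne'] at h
  rw [h, ← integral_const_mul]
  refine integral_congr_ae (ae_of_all _ fun s => ?_)
  have h1 : 1 + s ^ 2 ≠ 0 := by positivity
  have h2 : (ε * s) ^ 2 + ε ^ 2 ≠ 0 := by positivity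
  simp only
  rw [show x - (x + ε * s) = -(ε * s) by ring, neg_sq]
  field_simp
  ring

/-- The Poisson kernel is an approximate identity of total mass π. Fubini moves it onto φ, and t = x
+ εs replaces it by the fixed weight 1 / (1 + s²). -/
lemma tendsto_integral_mul_poisson {ν : Measure ℝ} [IsFiniteMeasure ν]
    (φ : CompactlySupportedContinuousMap ℝ ℝ)
    {ε : ℕ → ℝ} (hε0 : ∀ n, 0 < ε n) (hε : Tendsto ε atTop (𝓝 0)) :
    Tendsto (fun n => ∫ t, φ t * ∫ x, ε n / ((x - t) ^ 2 + ε n ^ 2) ∂ν) atTop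
      (𝓝 (Real.pi * ∫ x, φ x ∂ν)) := by
  have hφc : Continuous φ := φ.continuous
  obtain ⟨C, hC⟩ := φ.hasCompactSupport.exists_bound_of_continuous hφc
  have hφi : Integrable φ := hφc.integrable_of_hasCompactSupport φ.hasCompactSupport
  have hswap : ∀ n, ∫ t, φ t * ∫ x, ε n / ((x - t) ^ 2 + ε n ^ 2) ∂ν
      = ∫ x, (∫ s, φ (x + ε n * s) * (1 + s ^ 2)⁻¹) ∂ν := by
    intro n
    have hen := hε0 n
    simp only [← integral_const_mul]
    rw [integral_integral_swap]
    · exact integral_congr_ae (ae_of_all _ fun x => integral_mul_poisson_eq φ hen x)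
    · have h1 : Integrable (fun q : ℝ × ℝ => φ q.1) (volume.prod ν) := hφi.comp_fst ν
      refine (h1.norm.mul_const (ε n)⁻¹).mono' ?_ (ae_of_all _ fun q => ?_)
      · refine (hφc.measurable.comp measurable_fst |>.mul ?_).aestronglyMeasurable
        fun_prop
      · simp only [Function.uncurry]
        rw [norm_mul]
        refine mul_le_mul_of_nonneg_left ?_ (norm_nonneg _)
        rw [Real.norm_of_nonneg (by positivity), div_le_iff₀ (by positivity)]
        have : (ε n)⁻¹ * ((q.2 - q.1) ^ 2 + ε n ^ 2) = (ε n)⁻¹ * (q.2 - q.1) ^ 2 + ε n := by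
          field_simp
        rw [this]
        have : 0 ≤ (ε n)⁻¹ * (q.2 - q.1) ^ 2 := by positivity
        linarith
  simp only [hswap]
  have hlim : Real.pi * ∫ x, φ x ∂ν = ∫ x, (∫ s, φ x * (1 + s ^ 2)⁻¹) ∂ν := by
    simp only [integral_const_mul, integral_univ_inv_one_add_sq]
    rw [integral_mul_const, mul_comm]
  rw [hlim]
  have hC0 : 0 ≤ C := (norm_nonneg _).trans (hC 0)
  have hbd : ∀ y s : ℝ, ‖φ y * (1 + s ^ 2)⁻¹‖ ≤ C * (1 + s ^ 2)⁻¹ := fun y s => by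
    have : 0 ≤ (1 + s ^ 2)⁻¹ := by positivity
    rw [norm_mul, Real.norm_of_nonneg this]
    exact mul_le_mul_of_nonneg_right (hC y) this
  have hki : Integrable fun s : ℝ => C * (1 + s ^ 2)⁻¹ := integrable_inv_one_add_sq.const_mul C
  refine tendsto_integral_of_dominated_convergence (fun _ => C * Real.pi) (fun n => ?_)
    (integrable_const _) (fun n => ae_of_all _ fun x => ?_) (ae_of_all _ fun x => ?_)
  · have : Measurable fun q : ℝ × ℝ => φ (q.1 + ε n * q.2) * (1 + q.2 ^ 2)⁻¹ :=
      (hφc.measurable.comp (by fun_prop)).mul (by fun_prop)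
    exact this.stronglyMeasurable.integral_prod_right.aestronglyMeasurable
  · refine (norm_integral_le_of_norm_le hki (ae_of_all _ fun s => hbd _ s)).trans ?_
    rw [integral_const_mul, integral_univ_inv_one_add_sq]
  · refine tendsto_integral_of_dominated_convergence _ (fun n => ?_) hki
      (fun n => ae_of_all _ fun s => hbd _ s) (ae_of_all _ fun s => ?_)
    · exact ((hφc.measurable.comp (by fun_prop)).mul (by fun_prop)).aestronglyMeasurable
    · refine Tendsto.mul_const _ ((hφc.tendsto x).comp ?_)
      simpa using (tendsto_const_nhds (x := x)).add (hε.mul_const s)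

lemma cifarelliDensity_nonneg (G : Measure ℝ) (t : ℝ) : 0 ≤ cifarelliDensity G t := by
  have h1 : 0 ≤ Real.sin (Real.pi * cdf G t) :=
    Real.sin_nonneg_of_nonneg_of_le_pi (mul_nonneg Real.pi_pos.le (cdf_nonneg G t))
      (mul_le_of_le_one_right Real.pi_pos.le (cdf_le_one G t))
  have := Real.pi_pos
  unfold cifarelliDensity
  positivity

lemma measurable_cifarelliDensity (G : Measure ℝ) [SFinite G] :
    Measurable (cifarelliDensity G) := by
  have h1 := (stronglyMeasurable_integral_log_abs_sub G).measurable
  simp only [← logPotential_eq] at h1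
  have h2 : Measurable (cdf G) := (monotone_cdf G).measurable
  unfold cifarelliDensity
  fun_prop

lemma isLocallyFiniteMeasure_withDensity_ofReal {h : ℝ → ℝ} (hh : LocallyIntegrable h) :
    IsLocallyFiniteMeasure (volume.withDensity fun x => ENNReal.ofReal (h x)) := by
  refine ⟨fun x => ?_⟩
  obtain ⟨s, hs, hint⟩ := hh x
  refine ⟨s, hs, ?_⟩
  rw [withDensity_apply' _ s]
  refine lt_of_le_of_lt (lintegral_mono fun y => ?_) hint.hasFiniteIntegral
  exact Real.ofReal_le_enorm _

/-- A law on the half-line with Stieltjes transform `exp (-∫ log (x + w) G(dx))` has the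
Cifarelli–Regazzini density attached to `G`. -/
theorem HasMarkovTransform.eq_withDensity {ν G : Measure ℝ} [IsFiniteMeasure ν]
    [IsProbabilityMeasure G] (h : HasMarkovTransform ν G) (hν0 : ∀ᵐ x ∂ν, 0 ≤ x)
    (hG0 : ∀ᵐ x ∂G, 0 ≤ x) (hlog : Integrable (fun x => Real.log (1 + x)) G)
    (hatom : ∀ a, G {a} < 1) :
    ν = volume.withDensity fun t => ENNReal.ofReal (cifarelliDensity G t) := by
  set ε : ℕ → ℝ := fun n => 1 / ((n : ℝ) + 1)
  have hε0 : ∀ n, 0 < ε n := fun n => by positivity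
  have hε1 : ∀ n, ε n ≤ 1 := fun n => by
    rw [div_le_one (by positivity)]; linarith [n.cast_nonneg (α := ℝ)]
  have hε : Tendsto ε atTop (𝓝 0) := tendsto_one_div_add_atTop_nhds_zero_nat
  have hH := locallyIntegrable_exp_neg_logPotential hG0 hlog hatom
  have hmeas := measurable_cifarelliDensity G
  have hgood : ∀ᵐ t : ℝ, G {t} = 0 ∧ Integrable (fun x => Real.log |t - x|) G :=
    (ae_measure_singleton_eq_zero G).and (ae_integrable_log_abs_sub hG0 hlog)
  -- The bound on the smoothed densities is uniform in ε and so passes to their limit.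
  have hloc : LocallyIntegrable (cifarelliDensity G) := by
    refine hH.mono hmeas.aestronglyMeasurable ?_
    filter_upwards [hgood] with t ht
    rw [Real.norm_of_nonneg (Real.exp_pos _).le]
    refine le_of_tendsto (tendsto_smoothedDensity hG0 hlog ht.1 ht.2 hε0 hε1 hε).norm
      (Eventually.of_forall fun n => ?_)
    exact abs_smoothedDensity_le hG0 hlog (hε0 n) ht.1 ht.2
  have := isLocallyFiniteMeasure_withDensity_ofReal hloc
  -- Both measures are locally finite, so compactly supported continuous functions separate them;
  -- each integral is a limit of the same Poisson integrals.
  refine Measure.ext_of_integral_eq_on_compactlySupported fun φ => ?_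
  have hφc : Continuous φ := φ.continuous
  have hR : ∫ t, φ t ∂(volume.withDensity fun t => ENNReal.ofReal (cifarelliDensity G t))
      = ∫ t, φ t * cifarelliDensity G t := by
    rw [integral_withDensity_eq_integral_toReal_smul hmeas.ennreal_ofReal (by simp)]
    refine integral_congr_ae (ae_of_all _ fun t => ?_)
    simp only
    rw [ENNReal.toReal_ofReal (cifarelliDensity_nonneg G t), smul_eq_mul, mul_comm]
  rw [hR]
  have hbound : Integrable fun t => |φ t| * Real.exp (-∫ x, Real.log |t - x| ∂G) := by
    have := hH.integrable_smul_left_of_hasCompactSupport hφc.abs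
      (φ.hasCompactSupport.comp_left abs_zero)
    simpa [smul_eq_mul] using this
  have hsm : ∀ n t, smoothedDensity G (ε n) t
      = Real.pi⁻¹ * ∫ x, ε n / ((x - t) ^ 2 + ε n ^ 2) ∂ν := fun n t => by
    rw [smoothedDensity, h.integral_poisson hν0 hG0 hlog (hε0 n) t]
  have hT1 : Tendsto (fun n => ∫ t, φ t * smoothedDensity G (ε n) t) atTop
      (𝓝 (∫ t, φ t * cifarelliDensity G t)) := by
    refine tendsto_integral_of_dominated_convergence _ (fun n => ?_) hbound (fun n => ?_) ?_
    · simp only [hsm]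
      have : Measurable fun q : ℝ × ℝ => ε n / ((q.2 - q.1) ^ 2 + ε n ^ 2) := by fun_prop
      exact (hφc.measurable.mul
        (this.stronglyMeasurable.integral_prod_right.measurable.const_mul _)).aestronglyMeasurable
    · filter_upwards [hgood] with t ht
      rw [norm_mul]
      exact mul_le_mul_of_nonneg_left
        (abs_smoothedDensity_le hG0 hlog (hε0 n) ht.1 ht.2) (abs_nonneg _)
    · filter_upwards [hgood] with t ht
      exact (tendsto_smoothedDensity hG0 hlog ht.1 ht.2 hε0 hε1 hε).const_mul _
  have hT2 := (tendsto_integral_mul_poisson (ν := ν) φ hε0 hε).const_mul Real.pi⁻¹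
  rw [inv_mul_cancel_left₀ Real.pi_pos.ne'] at hT2
  refine tendsto_nhds_unique hT2 (hT1.congr fun n => ?_)
  rw [← integral_const_mul]
  refine integral_congr_ae (ae_of_all _ fun t => ?_)
  simp only [hsm]
  ring

/-! ### Laws of products with an independent Bernoulli variable -/

/-- The mixture `σ F + (1 - σ) δ₀`. -/
noncomputable def zeroInflated (σ : ℝ) (F : Measure ℝ) : Measure ℝ :=
  ENNReal.ofReal σ • F + ENNReal.ofReal (1 - σ) • Measure.dirac 0

section ZeroInflated

variable {σ : ℝ} {F : Measure ℝ}

lemma isProbabilityMeasure_zeroInflated [IsProbabilityMeasure F] (hσ0 : 0 ≤ σ) (hσ1 : σ ≤ 1) :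
    IsProbabilityMeasure (zeroInflated σ F) := by
  refine ⟨?_⟩
  simp only [zeroInflated, Measure.coe_add, Measure.coe_smul, Pi.add_apply, Pi.smul_apply,
    measure_univ, smul_eq_mul, mul_one]
  rw [← ENNReal.ofReal_add hσ0 (by linarith)]
  simp

lemma ae_zeroInflated {p : ℝ → Prop} (hp : ∀ᵐ x ∂F, p x) (h0 : p 0)
    (hm : MeasurableSet {x | p x}) : ∀ᵐ x ∂zeroInflated σ F, p x := by
  rw [zeroInflated, ae_add_measure_iff]
  refine ⟨Measure.ae_smul_measure hp _, Measure.ae_smul_measure ?_ _⟩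
  rwa [ae_dirac_iff hm]

lemma integrable_zeroInflated {f : ℝ → ℝ} (hf : Measurable f) (hi : Integrable f F) :
    Integrable f (zeroInflated σ F) :=
  (hi.smul_measure ENNReal.ofReal_ne_top).add_measure
    ((integrable_dirac' hf.stronglyMeasurable (by simp)).smul_measure ENNReal.ofReal_ne_top)

lemma integral_zeroInflated (hσ0 : 0 ≤ σ) (hσ1 : σ ≤ 1) {f : ℝ → ℝ} (hf : Measurable f)
    (hi : Integrable f F) :
    ∫ x, f x ∂zeroInflated σ F = σ * ∫ x, f x ∂F + (1 - σ) * f 0 := by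
  rw [zeroInflated, integral_add_measure (hi.smul_measure ENNReal.ofReal_ne_top)
    ((integrable_dirac' hf.stronglyMeasurable (by simp)).smul_measure ENNReal.ofReal_ne_top),
    integral_smul_measure, integral_smul_measure, integral_dirac' _ _ hf.stronglyMeasurable,
    ENNReal.toReal_ofReal hσ0, ENNReal.toReal_ofReal (by linarith), smul_eq_mul, smul_eq_mul]

lemma map_zeroInflated {T : ℝ → ℝ} (hT : Measurable T) (hT0 : T 0 = 0) :
    (zeroInflated σ F).map T = zeroInflated σ (F.map T) := by
  rw [zeroInflated, Measure.map_add _ _ hT, Measure.map_smul, Measure.map_smul,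
    Measure.map_dirac' hT, hT0]
  rfl

lemma levyExponent_zeroInflated [IsFiniteMeasure F] (hσ0 : 0 ≤ σ) (hσ1 : σ ≤ 1)
    (hF0 : ∀ᵐ x ∂F, 0 ≤ x) (hlog : Integrable (fun x => Real.log (1 + x)) F)
    {c : ℝ} (hc : 0 < c) : levyExponent (zeroInflated σ F) c = σ * levyExponent F c := by
  rw [levyExponent, integral_zeroInflated hσ0 hσ1
    (by fun_prop : Measurable fun x : ℝ => 1 + c * x).log (integrable_log_one_add_mul hF0 hlog hc), levyExponent]
  simp

lemma logPotential_zeroInflated (hσ0 : 0 ≤ σ) (hσ1 : σ ≤ 1) {t : ℝ}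
    (ht : Integrable (fun x => Real.log |t - x|) F) :
    logPotential (zeroInflated σ F) t = σ * logPotential F t + (1 - σ) * Real.log |t| := by
  rw [logPotential_eq, integral_zeroInflated hσ0 hσ1
    (by fun_prop : Measurable fun x : ℝ => |t - x|).log ht,
    logPotential_eq, sub_zero]

end ZeroInflated

lemma map_mul_bernoulli {Ω : Type*} [MeasurableSpace Ω] {μ : Measure Ω} [IsProbabilityMeasure μ]
    {σ : ℝ} (hσ : σ ∈ unitInterval) {X Y : Ω → ℝ} (hX : AEMeasurable X μ)
    (hY : HasLaw Y (bernoulliMeasure (1 : ℝ) 0 ⟨σ, hσ⟩) μ) (hXY : IndepFun X Y μ) :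
    μ.map (fun ω => X ω * Y ω) = zeroInflated σ (μ.map X) := by
  have hpX := Measure.isProbabilityMeasure_map hX
  have hprod := (indepFun_iff_map_prod_eq_prod_map_map hX hY.aemeasurable).1 hXY
  have hXYm : AEMeasurable (fun ω => X ω * Y ω) μ := hX.mul hY.aemeasurable
  rw [hY.map_eq] at hprod
  refine Measure.ext_of_lintegral _ fun f hf => ?_
  have h1 : ∫⁻ x, f x ∂μ.map (fun ω => X ω * Y ω)
      = ∫⁻ q, f (q.1 * q.2) ∂μ.map (fun ω => (X ω, Y ω)) := by
    rw [lintegral_map' hf.aemeasurable hXYm,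
      lintegral_map' (by fun_prop) (hX.prodMk hY.aemeasurable)]
  rw [h1, hprod, lintegral_prod_symm' _ (by fun_prop), bernoulliMeasure_def,
    lintegral_add_measure, lintegral_smul_measure, lintegral_smul_measure]
  have hm : Measurable fun y => ∫⁻ x, f (x * y) ∂μ.map X :=
    Measurable.lintegral_prod_left' (f := fun q : ℝ × ℝ => f (q.1 * q.2)) (by fun_prop)
  rw [lintegral_dirac' _ hm, lintegral_dirac' _ hm, zeroInflated, lintegral_add_measure,
    lintegral_smul_measure, lintegral_smul_measure, lintegral_dirac' _ hf]
  have e1 : ((unitInterval.toNNReal ⟨σ, hσ⟩ : NNReal) : ENNReal) = ENNReal.ofReal σ := by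
    rw [ENNReal.ofReal, ENNReal.coe_inj]
    ext
    simp [Real.coe_toNNReal _ hσ.1]
  have e2 : ((unitInterval.toNNReal (unitInterval.symm ⟨σ, hσ⟩) : NNReal) : ENNReal)
      = ENNReal.ofReal (1 - σ) := by
    rw [ENNReal.ofReal, ENNReal.coe_inj]
    ext
    simp [Real.coe_toNNReal _ (sub_nonneg.2 hσ.2)]
  simp only [mul_one, mul_zero, lintegral_const, measure_univ, ENNReal.smul_def, e1, e2]

/-! ### The laws of Dirichlet means -/

/-- With w = 1/c one has x + w = w (1 + c x); the factor w comes out of the integral on one side and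
as exp(-log w) on the other, because G has mass one. -/
lemma hasMarkovTransform_of_lintegral {ν G : Measure ℝ} [IsProbabilityMeasure G]
    (hν0 : ∀ᵐ x ∂ν, 0 ≤ x) (hG0 : ∀ᵐ x ∂G, 0 ≤ x)
    (hlog : Integrable (fun x => Real.log (1 + x)) G)
    (h : ∀ c : ℝ, 0 < c → ∫⁻ x, ENNReal.ofReal ((1 + c * x)⁻¹) ∂ν
      = ENNReal.ofReal (Real.exp (-levyExponent G c))) :
    HasMarkovTransform ν G := by
  intro w hw
  have h1 := h w⁻¹ (inv_pos.2 hw)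
  have h2 : ∫ x, (1 + w⁻¹ * x)⁻¹ ∂ν = Real.exp (-levyExponent G w⁻¹) := by
    rw [integral_eq_lintegral_of_nonneg_ae, h1, ENNReal.toReal_ofReal (Real.exp_pos _).le]
    · filter_upwards [hν0] with x hx
      simp only [Pi.zero_apply]
      positivity
    · exact (by fun_prop : Measurable fun x : ℝ => (1 + w⁻¹ * x)⁻¹).aestronglyMeasurable
  have h3 : ∀ x : ℝ, (x + w)⁻¹ = w⁻¹ * (1 + w⁻¹ * x)⁻¹ := fun x => by
    rw [← mul_inv, mul_add, mul_one, mul_inv_cancel_left₀ hw.ne', add_comm]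
  have h4 : ∫ x, Real.log (x + w) ∂G = Real.log w + levyExponent G w⁻¹ := by
    have h5 : ∫ x, Real.log (x + w) ∂G = ∫ x, (Real.log w + Real.log (1 + w⁻¹ * x)) ∂G := by
      refine integral_congr_ae ?_
      filter_upwards [hG0] with x hx
      have : 0 < 1 + w⁻¹ * x := by positivity
      rw [← Real.log_mul hw.ne' this.ne', mul_add, mul_one, mul_inv_cancel_left₀ hw.ne', add_comm]
    rw [h5, integral_add (integrable_const _)
      (integrable_log_one_add_mul hG0 hlog (inv_pos.2 hw)), levyExponent]
    simp
  simp only [h3]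
  rw [integral_const_mul, h2, h4, neg_add, Real.exp_add, Real.exp_neg (Real.log w),
    Real.exp_log hw]

lemma ae_betaLaw_nonneg (a b : ℝ) : ∀ᵐ x ∂betaLaw a b, 0 ≤ x := by
  unfold betaLaw
  split_ifs
  · rw [ae_dirac_iff (by exact measurableSet_Ici)]
    exact zero_le_one
  · have hm : Measurable (betaPDF a b) := (measurable_betaPDFReal _ _).ennreal_ofReal
    rw [betaMeasure, ae_withDensity_iff hm]
    refine ae_of_all _ fun x hx => ?_
    by_contra hneg
    exact hx (betaPDF_eq_zero_of_nonpos (not_le.1 hneg).le)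

lemma isProbabilityMeasure_betaLaw {a b : ℝ} (ha : 0 < a) (hb : 0 ≤ b) :
    IsProbabilityMeasure (betaLaw a b) := by
  unfold betaLaw
  split_ifs with h
  · infer_instance
  · exact isProbabilityMeasureBeta ha (lt_of_le_of_ne hb (Ne.symm h))

section Means

variable {Ω : Type*} [MeasurableSpace Ω] {μ : Measure Ω} [IsProbabilityMeasure μ]

/-- The law of the mean of a Dirichlet process of total mass one. -/
theorem IsDirichletProcess.map_meanFunctional {G : Measure ℝ} [IsProbabilityMeasure G]
    (hG0 : ∀ᵐ x ∂G, 0 ≤ x) (hlog : Integrable (fun x => Real.log (1 + x)) G)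
    (hatom : ∀ a, G {a} < 1) {P : Ω → Measure ℝ} (hP : IsDirichletProcess 1 G P μ) :
    μ.map (meanFunctional P)
      = volume.withDensity fun t => ENNReal.ofReal (cifarelliDensity G t) := by
  have hm := hP.measurable_meanFunctional
  have hpr := Measure.isProbabilityMeasure_map hm.aemeasurable (μ := μ)
  have hν0 : ∀ᵐ x ∂μ.map (meanFunctional P), 0 ≤ x := by
    rw [ae_map_iff hm.aemeasurable measurableSet_Ici]
    filter_upwards [hP.ae_ofReal_meanFunctional one_pos hG0 hlog] with ω hω
    exact hω.1
  refine (hasMarkovTransform_of_lintegral hν0 hG0 hlog fun c hc => ?_).eq_withDensity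
    hν0 hG0 hlog hatom
  have h := hP.lintegral_meanFunctional_rpow one_pos hG0 hlog hc
  rw [lintegral_map (by fun_prop) hm]
  simpa [Real.rpow_neg_one] using h

/-- The law of the product of a Dirichlet mean of total mass `σ` with an independent
`beta(σ, 1 - σ)` variable. -/
theorem IsDirichletProcess.map_beta_mul_meanFunctional {σ : ℝ} (hσ0 : 0 < σ) (hσ1 : σ ≤ 1)
    {F : Measure ℝ} [IsProbabilityMeasure F] (hF0 : ∀ᵐ x ∂F, 0 ≤ x)
    (hlog : Integrable (fun x => Real.log (1 + x)) F)
    (hatom : ∀ a, zeroInflated σ F {a} < 1) {Q : Ω → Measure ℝ} {B : Ω → ℝ}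
    (hQ : IsDirichletProcess σ F Q μ) (hB : HasLaw B (betaLaw σ (1 - σ)) μ)
    (hind : IndepFun B (meanFunctional Q) μ) :
    μ.map (fun ω => B ω * meanFunctional Q ω)
      = volume.withDensity fun t => ENNReal.ofReal (cifarelliDensity (zeroInflated σ F) t) := by
  have hG := isProbabilityMeasure_zeroInflated (F := F) hσ0.le hσ1
  have hG0 : ∀ᵐ x ∂zeroInflated σ F, 0 ≤ x := ae_zeroInflated hF0 le_rfl measurableSet_Ici
  have hGlog := integrable_zeroInflated (σ := σ)
    (by fun_prop : Measurable fun x : ℝ => 1 + x).log hlog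
  have hm := hQ.measurable_meanFunctional
  have hBm := hB.aemeasurable
  have hBQ : AEMeasurable (fun ω => B ω * meanFunctional Q ω) μ := hBm.mul hm.aemeasurable
  have hbp := isProbabilityMeasure_betaLaw hσ0 (sub_nonneg.2 hσ1)
  have hpm := Measure.isProbabilityMeasure_map hm.aemeasurable (μ := μ)
  have hpr := Measure.isProbabilityMeasure_map hBQ (μ := μ)
  have hprod := (indepFun_iff_map_prod_eq_prod_map_map hBm hm.aemeasurable).1 hind
  rw [hB.map_eq] at hprod
  have hB0 : ∀ᵐ ω ∂μ, 0 ≤ B ω := by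
    have := ae_betaLaw_nonneg σ (1 - σ)
    rw [← hB.map_eq] at this
    exact ae_of_ae_map hBm this
  have hM0 : ∀ᵐ ω ∂μ, 0 ≤ meanFunctional Q ω := by
    filter_upwards [hQ.ae_ofReal_meanFunctional hσ0 hF0 hlog] with ω hω
    exact hω.1
  have hν0 : ∀ᵐ x ∂μ.map (fun ω => B ω * meanFunctional Q ω), 0 ≤ x := by
    rw [ae_map_iff hBQ measurableSet_Ici]
    filter_upwards [hB0, hM0] with ω h1 h2
    exact mul_nonneg h1 h2
  refine (hasMarkovTransform_of_lintegral hν0 hG0 hGlog fun c hc => ?_).eq_withDensity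
    hν0 hG0 hGlog hatom
  have hmf : Measurable fun q : ℝ × ℝ => ENNReal.ofReal ((1 + c * (q.1 * q.2))⁻¹) := by fun_prop
  have h1 : ∫⁻ x, ENNReal.ofReal ((1 + c * x)⁻¹) ∂μ.map (fun ω => B ω * meanFunctional Q ω)
      = ∫⁻ q, ENNReal.ofReal ((1 + c * (q.1 * q.2))⁻¹)
          ∂μ.map (fun ω => (B ω, meanFunctional Q ω)) := by
    rw [lintegral_map' (by fun_prop) hBQ,
      lintegral_map' hmf.aemeasurable (hBm.prodMk hm.aemeasurable)]
  have hmr : Measurable fun m : ℝ => ENNReal.ofReal ((1 + c * m) ^ (-σ)) := by fun_prop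
  -- Given the mean m, the beta identity with z = cm integrates out the beta factor and leaves the
  -- order-σ transform of the Dirichlet mean.
  have h2 : ∫⁻ m, (∫⁻ b, ENNReal.ofReal ((1 + c * (b * m))⁻¹) ∂betaLaw σ (1 - σ))
        ∂μ.map (meanFunctional Q)
      = ∫⁻ m, ENNReal.ofReal ((1 + c * m) ^ (-σ)) ∂μ.map (meanFunctional Q) := by
    refine lintegral_congr_ae ?_
    have hM0' : ∀ᵐ m ∂μ.map (meanFunctional Q), 0 ≤ m :=
      (ae_map_iff hm.aemeasurable measurableSet_Ici).2 hM0
    filter_upwards [hM0'] with m hm0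
    rw [← lintegral_betaLaw_inv hσ0 hσ1 (mul_nonneg hc.le hm0)]
    refine lintegral_congr fun b => ?_
    ring_nf
  rw [h1, hprod, lintegral_prod_symm' _ hmf, h2, lintegral_map hmr hm,
    hQ.lintegral_meanFunctional_rpow hσ0 hF0 hlog hc,
    levyExponent_zeroInflated hσ0.le hσ1 hF0 hlog hc, neg_mul]

end Means

/-! ### The tilting map `x ↦ c x / (c x + 1)` -/

/-- The tilting map `x ↦ c x / (c x + 1)`. -/
noncomputable def tiltMap (c x : ℝ) : ℝ := c * x / (c * x + 1)

section Tilt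

variable {c : ℝ}

lemma measurable_tiltMap (c : ℝ) : Measurable (tiltMap c) := by
  unfold tiltMap
  fun_prop

@[simp]
lemma tiltMap_zero (c : ℝ) : tiltMap c 0 = 0 := by simp [tiltMap]

lemma tiltMap_nonneg (hc : 0 < c) {x : ℝ} (hx : 0 ≤ x) : 0 ≤ tiltMap c x := by
  unfold tiltMap
  positivity

lemma tiltMap_lt_one (hc : 0 < c) {x : ℝ} (hx : 0 ≤ x) : tiltMap c x < 1 := by
  have : 0 ≤ c * x := by positivity
  rw [tiltMap, div_lt_one (by linarith)]
  linarith

lemma tiltMap_le_iff (hc : 0 < c) {x y : ℝ} (hx : 0 ≤ x) (hy : y < 1) :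
    tiltMap c x ≤ y ↔ x ≤ y / (c * (1 - y)) := by
  have h1 : 0 ≤ c * x := by positivity
  have h2 : 0 < 1 - y := sub_pos.2 hy
  rw [tiltMap, div_le_iff₀ (by linarith), le_div_iff₀ (by positivity)]
  constructor <;> intro h <;> linarith

lemma tiltMap_div (hc : 0 < c) {y : ℝ} (hy : y < 1) : tiltMap c (y / (c * (1 - y))) = y := by
  have h2 : 1 - y ≠ 0 := (sub_pos.2 hy).ne'
  unfold tiltMap
  field_simp
  ring

lemma tiltMap_injOn (hc : 0 < c) : Set.InjOn (tiltMap c) (Set.Ici 0) := by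
  intro x hx y hy h
  have h1 : 0 < c * x + 1 := by have : 0 ≤ x := hx; positivity
  have h2 : 0 < c * y + 1 := by have : 0 ≤ y := hy; positivity
  rw [tiltMap, tiltMap, div_eq_div_iff h1.ne' h2.ne'] at h
  have h3 : c * (x - y) = 0 := by linarith
  rcases mul_eq_zero.1 h3 with h4 | h4 <;> linarith

/-- Differences under this Möbius map factorise as c (t - x) / ((1 + ct)(1 + cx)). The point x = t
is excluded because `Real.log 0 = 0` breaks the formula there in general. -/
lemma log_abs_tiltMap_sub (hc : 0 < c) {t x : ℝ} (ht : 0 ≤ t) (hx : 0 ≤ x) (hne : x ≠ t) :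
    Real.log |tiltMap c t - tiltMap c x|
      = Real.log c + Real.log |t - x| - Real.log (1 + c * t) - Real.log (1 + c * x) := by
  have h1 : 0 < 1 + c * t := by positivity
  have h2 : 0 < 1 + c * x := by positivity
  have h3 : tiltMap c t - tiltMap c x = c * (t - x) / ((1 + c * t) * (1 + c * x)) := by
    unfold tiltMap
    rw [add_comm (c * t), add_comm (c * x)]
    field_simp
    ring
  have h4 : |t - x| ≠ 0 := abs_ne_zero.2 (sub_ne_zero.2 hne.symm)
  rw [h3, abs_div, abs_mul, abs_of_pos hc, abs_of_pos (mul_pos h1 h2),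
    Real.log_div (mul_ne_zero hc.ne' h4) (mul_pos h1 h2).ne', Real.log_mul hc.ne' h4,
    Real.log_mul h1.ne' h2.ne']
  ring

variable {F : Measure ℝ}

lemma ae_map_tiltMap_nonneg (hc : 0 < c) (hF0 : ∀ᵐ x ∂F, 0 ≤ x) :
    ∀ᵐ x ∂F.map (tiltMap c), 0 ≤ x := by
  rw [ae_map_iff (measurable_tiltMap c).aemeasurable measurableSet_Ici]
  filter_upwards [hF0] with x hx using tiltMap_nonneg hc hx

lemma ae_map_tiltMap_lt_one (hc : 0 < c) (hF0 : ∀ᵐ x ∂F, 0 ≤ x) :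
    ∀ᵐ x ∂F.map (tiltMap c), x < 1 := by
  rw [ae_map_iff (measurable_tiltMap c).aemeasurable measurableSet_Iio]
  filter_upwards [hF0] with x hx using tiltMap_lt_one hc hx

lemma integrable_log_one_add_map_tiltMap [IsFiniteMeasure F] (hc : 0 < c)
    (hF0 : ∀ᵐ x ∂F, 0 ≤ x) : Integrable (fun x => Real.log (1 + x)) (F.map (tiltMap c)) := by
  refine (integrable_const (Real.log 2)).mono'
    (by fun_prop : Measurable fun x : ℝ => 1 + x).log.aestronglyMeasurable ?_
  filter_upwards [ae_map_tiltMap_nonneg hc hF0, ae_map_tiltMap_lt_one hc hF0] with x h0 h1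
  rw [Real.norm_of_nonneg (Real.log_nonneg (by linarith))]
  exact Real.log_le_log (by linarith) (by linarith)

lemma map_tiltMap_singleton_lt_one (hc : 0 < c) (hF0 : ∀ᵐ x ∂F, 0 ≤ x)
    (hatom : ∀ a, F {a} < 1) (a : ℝ) : F.map (tiltMap c) {a} < 1 := by
  rw [Measure.map_apply (measurable_tiltMap c) (measurableSet_singleton a)]
  by_cases h : ∃ b, 0 ≤ b ∧ tiltMap c b = a
  · obtain ⟨b, hb, rfl⟩ := h
    refine lt_of_le_of_lt (measure_mono_ae ?_) (hatom b)
    filter_upwards [hF0] with x hx hxa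
    exact tiltMap_injOn hc hx hb hxa
  · refine lt_of_le_of_lt (le_of_eq ?_) zero_lt_one
    rw [measure_eq_zero_iff_ae_notMem]
    filter_upwards [hF0] with x hx hxa
    exact h ⟨x, hx, hxa⟩

lemma cdf_map_tiltMap [IsProbabilityMeasure F] (hc : 0 < c) (hF0 : ∀ᵐ x ∂F, 0 ≤ x) {y : ℝ}
    (hy : y < 1) : cdf (F.map (tiltMap c)) y = cdf F (y / (c * (1 - y))) := by
  have := Measure.isProbabilityMeasure_map (measurable_tiltMap c).aemeasurable (μ := F)
  rw [cdf_eq_real, cdf_eq_real, measureReal_def,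
    Measure.map_apply (measurable_tiltMap c) measurableSet_Iic, measureReal_def]
  congr 1
  refine measure_congr ?_
  filter_upwards [hF0] with x hx
  exact propext (tiltMap_le_iff hc hx hy)

lemma integrable_log_abs_tiltMap_iff [IsFiniteMeasure F] (hc : 0 < c) (hF0 : ∀ᵐ x ∂F, 0 ≤ x)
    (hlog : Integrable (fun x => Real.log (1 + x)) F) {t : ℝ} (ht : 0 ≤ t) (hFt : F {t} = 0) :
    Integrable (fun y => Real.log |tiltMap c t - y|) (F.map (tiltMap c))
      ↔ Integrable (fun x => Real.log |t - x|) F := by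
  have hm : Measurable fun y => Real.log |tiltMap c t - y| :=
    (by fun_prop : Measurable fun y : ℝ => |tiltMap c t - y|).log
  rw [integrable_map_measure hm.aestronglyMeasurable (measurable_tiltMap c).aemeasurable]
  have hlc := integrable_log_one_add_mul hF0 hlog hc
  constructor
  · intro h
    refine (((h.add hlc).add (integrable_const (Real.log (1 + c * t)))).sub
      (integrable_const (Real.log c))).congr ?_
    filter_upwards [hF0, ae_ne_of_measure_singleton hFt] with x hx hne
    simp only [Pi.add_apply, Pi.sub_apply, Function.comp, log_abs_tiltMap_sub hc ht hx hne]
    ring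
  · intro h
    refine ((((integrable_const (Real.log c)).add h).sub
      (integrable_const (Real.log (1 + c * t)))).sub hlc).congr ?_
    filter_upwards [hF0, ae_ne_of_measure_singleton hFt] with x hx hne
    simp only [Pi.add_apply, Pi.sub_apply, Function.comp, log_abs_tiltMap_sub hc ht hx hne]

lemma logPotential_map_tiltMap [IsProbabilityMeasure F] (hc : 0 < c) (hF0 : ∀ᵐ x ∂F, 0 ≤ x)
    (hlog : Integrable (fun x => Real.log (1 + x)) F) {t : ℝ} (ht : 0 ≤ t) (hFt : F {t} = 0)
    (hti : Integrable (fun x => Real.log |t - x|) F) :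
    logPotential (F.map (tiltMap c)) (tiltMap c t)
      = Real.log c + logPotential F t - Real.log (1 + c * t) - levyExponent F c := by
  have hm : Measurable fun y => Real.log |tiltMap c t - y| :=
    (by fun_prop : Measurable fun y : ℝ => |tiltMap c t - y|).log
  rw [logPotential_eq, integral_map (measurable_tiltMap c).aemeasurable hm.aestronglyMeasurable]
  have h1 : (fun x => Real.log |tiltMap c t - tiltMap c x|) =ᵐ[F]
      fun x => Real.log c + Real.log |t - x| - Real.log (1 + c * t) - Real.log (1 + c * x) := by
    filter_upwards [hF0, ae_ne_of_measure_singleton hFt] with x hx hne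
    exact log_abs_tiltMap_sub hc ht hx hne
  have i1 := (integrable_const (μ := F) (Real.log c)).add hti
  have i2 := i1.sub (integrable_const (Real.log (1 + c * t)))
  have i3 := integrable_log_one_add_mul hF0 hlog hc
  have h2 : ∫ x, (Real.log c + Real.log |t - x| - Real.log (1 + c * t) - Real.log (1 + c * x)) ∂F
      = ∫ x, (Real.log c + Real.log |t - x| - Real.log (1 + c * t)) ∂F
        - ∫ x, Real.log (1 + c * x) ∂F := integral_sub i2 i3
  have h3 : ∫ x, (Real.log c + Real.log |t - x| - Real.log (1 + c * t)) ∂F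
      = ∫ x, (Real.log c + Real.log |t - x|) ∂F - ∫ _, Real.log (1 + c * t) ∂F :=
    integral_sub i1 (integrable_const _)
  rw [integral_congr_ae h1, h2, h3, integral_add (integrable_const _) hti, logPotential_eq,
    levyExponent]
  simp

end Tilt

/-! ### Densities -/

lemma hasDensityOn_of_eq_withDensity {ν : Measure ℝ} {S : Set ℝ} {h ξ : ℝ → ℝ}
    (hS : MeasurableSet S) (hν : ν = volume.withDensity fun x => ENNReal.ofReal (h x))
    (hin : ∀ᵐ x : ℝ, x ∈ S → ξ x = h x) (hout : ∀ᵐ x : ℝ, x ∉ S → h x = 0) :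
    HasDensityOn ν S ξ := by
  rw [HasDensityOn, hν, ← withDensity_indicator hS]
  refine withDensity_congr_ae ?_
  filter_upwards [hin, hout] with x h1 h2
  by_cases hx : x ∈ S
  · rw [Set.indicator_of_mem hx, h1 hx]
  · rw [Set.indicator_of_notMem hx, h2 hx, ENNReal.ofReal_zero]

/-- Off the support the sine vanishes: its argument is 0 to the left and, in the next lemma, π to
the right. -/
lemma cifarelliDensity_of_neg {G : Measure ℝ} [IsProbabilityMeasure G] (hG0 : ∀ᵐ x ∂G, 0 ≤ x)
    {t : ℝ} (ht : t < 0) : cifarelliDensity G t = 0 := by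
  have h : cdf G t = 0 := by
    rw [cdf_eq_real, measureReal_eq_zero_iff, measure_eq_zero_iff_ae_notMem]
    filter_upwards [hG0] with x hx hxt
    exact (hx.trans hxt).not_gt ht
  simp [cifarelliDensity, h]

lemma cifarelliDensity_of_one_le {G : Measure ℝ} [IsProbabilityMeasure G] (hG1 : ∀ᵐ x ∂G, x < 1)
    {t : ℝ} (ht : 1 ≤ t) : cifarelliDensity G t = 0 := by
  have h : cdf G t = 1 := by
    rw [cdf_eq_real, measureReal_def, ENNReal.toReal_eq_one_iff,
      ← mem_ae_iff_prob_eq_one measurableSet_Iic]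
    filter_upwards [hG1] with x hx
    exact hx.le.trans ht
  simp [cifarelliDensity, h]

lemma ae_ne_real (a : ℝ) : ∀ᵐ x : ℝ, x ≠ a := compl_mem_ae_iff.2 (measure_singleton a)

section Comparison

variable {F : Measure ℝ} [IsProbabilityMeasure F] {σ : ℝ}

/-- With y the tilt of t, 1 + ct = 1 / (1 - y). The change of potential under the tilt supplies
e^(σψ), c^(-σ) and (1 - y)^(-σ), while the mass 1 - σ at 0 supplies y^(σ-1). -/
lemma ae_cifarelliDensity_map_tiltMap (hσ0 : 0 ≤ σ) (hσ1 : σ ≤ 1) (hF0 : ∀ᵐ x ∂F, 0 ≤ x)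
    (hlog : Integrable (fun x => Real.log (1 + x)) F) {c : ℝ} (hc : 0 < c) :
    ∀ᵐ y : ℝ, y ∈ Set.Ioo (0 : ℝ) 1 →
      Real.exp (σ * levyExponent F c) * y ^ (σ - 1) / (Real.pi * c ^ σ * (1 - y) ^ σ)
        * Real.sin (Real.pi * cdf (zeroInflated σ F) (y / (c * (1 - y))))
        * Real.exp (-σ * logPotential F (y / (c * (1 - y))))
      = cifarelliDensity (zeroInflated σ (F.map (tiltMap c))) y := by
  have hm := measurable_tiltMap c
  have hp := Measure.isProbabilityMeasure_map hm.aemeasurable (μ := F)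
  have hG := isProbabilityMeasure_zeroInflated (F := F) hσ0 hσ1
  filter_upwards [ae_measure_singleton_eq_zero (F.map (tiltMap c)),
    ae_integrable_log_abs_sub (ae_map_tiltMap_nonneg hc hF0)
      (integrable_log_one_add_map_tiltMap hc hF0)] with y hy1 hy2 hy
  have hy0 := hy.1
  have hy1' : 0 < 1 - y := sub_pos.2 hy.2
  set t := y / (c * (1 - y)) with ht
  have ht0 : 0 ≤ t := by positivity
  have hty : tiltMap c t = y := tiltMap_div hc hy.2
  have hFt : F {t} = 0 := by
    rw [Measure.map_apply hm (measurableSet_singleton y)] at hy1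
    exact measure_mono_null (Set.singleton_subset_iff.2 hty) hy1
  have hti : Integrable (fun x => Real.log |t - x|) F :=
    (integrable_log_abs_tiltMap_iff hc hF0 hlog ht0 hFt).1 (by rwa [hty])
  have hΦ := logPotential_map_tiltMap hc hF0 hlog ht0 hFt hti
  have h1t : 1 + c * t = (1 - y)⁻¹ := by
    rw [ht]
    field_simp
    ring
  rw [hty, h1t, Real.log_inv] at hΦ
  have hcdf : cdf (zeroInflated σ (F.map (tiltMap c))) y = cdf (zeroInflated σ F) t := by
    rw [← map_zeroInflated hm (tiltMap_zero c),
      cdf_map_tiltMap hc (ae_zeroInflated hF0 le_rfl measurableSet_Ici) hy.2]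
  rw [cifarelliDensity, hcdf, logPotential_zeroInflated hσ0 hσ1 hy2, hΦ, abs_of_pos hy0,
    Real.rpow_def_of_pos hy0, Real.rpow_def_of_pos hc, Real.rpow_def_of_pos hy1']
  have he : Real.exp (-(σ * (Real.log c + logPotential F t - -Real.log (1 - y) - levyExponent F c)
        + (1 - σ) * Real.log y))
      = Real.exp (σ * levyExponent F c) * Real.exp (Real.log y * (σ - 1))
        * (Real.exp (Real.log c * σ))⁻¹ * (Real.exp (Real.log (1 - y) * σ))⁻¹
        * Real.exp (-σ * logPotential F t) := by
    rw [← Real.exp_neg, ← Real.exp_neg, ← Real.exp_add, ← Real.exp_add, ← Real.exp_add,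
      ← Real.exp_add]
    ring_nf
  rw [he]
  field_simp

/-- The same change of potential, for c = 1, is read backwards: rewriting Φ_F through the tilted law
costs the factor e^(-σψ) (1 + x)^(-σ). -/
lemma ae_cifarelliDensity_zeroInflated (hσ0 : 0 ≤ σ) (hσ1 : σ ≤ 1) (hF0 : ∀ᵐ x ∂F, 0 ≤ x)
    (hlog : Integrable (fun x => Real.log (1 + x)) F) :
    ∀ᵐ x : ℝ, x ∈ Set.Ioi (0 : ℝ) →
      Real.exp (-σ * levyExponent F 1) * x ^ (σ - 1) / (Real.pi * (1 + x) ^ σ)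
        * Real.sin (Real.pi * cdf (zeroInflated σ (F.map (tiltMap 1))) (x / (1 + x)))
        * Real.exp (-σ * logPotential (F.map (tiltMap 1)) (x / (1 + x)))
      = cifarelliDensity (zeroInflated σ F) x := by
  have hm := measurable_tiltMap 1
  have hG := isProbabilityMeasure_zeroInflated (F := F) hσ0 hσ1
  filter_upwards [ae_measure_singleton_eq_zero F, ae_integrable_log_abs_sub hF0 hlog] with x h1 h2 hx
  have hx0 : 0 < x := hx
  have hx1 : 0 < 1 + x := by linarith
  have hT : tiltMap 1 x = x / (1 + x) := by simp [tiltMap, add_comm]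
  have hΦ := logPotential_map_tiltMap one_pos hF0 hlog hx0.le h1 h2
  rw [hT, Real.log_one, one_mul] at hΦ
  have hlt : x / (1 + x) < 1 := by
    rw [div_lt_one hx1]
    linarith
  have hinv : x / (1 + x) / (1 * (1 - x / (1 + x))) = x := by
    field_simp
    ring
  have hcdf : cdf (zeroInflated σ (F.map (tiltMap 1))) (x / (1 + x)) = cdf (zeroInflated σ F) x := by
    rw [← map_zeroInflated hm (tiltMap_zero 1),
      cdf_map_tiltMap one_pos (ae_zeroInflated hF0 le_rfl measurableSet_Ici) hlt, hinv]
  rw [cifarelliDensity, hcdf, hΦ, logPotential_zeroInflated hσ0 hσ1 h2, abs_of_pos hx0,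
    Real.rpow_def_of_pos hx0, Real.rpow_def_of_pos hx1]
  have he : Real.exp (-(σ * logPotential F x + (1 - σ) * Real.log x))
      = Real.exp (-σ * levyExponent F 1) * Real.exp (Real.log x * (σ - 1))
        * (Real.exp (Real.log (1 + x) * σ))⁻¹
        * Real.exp (-σ * (0 + logPotential F x - Real.log (1 + x) - levyExponent F 1)) := by
    rw [← Real.exp_neg, ← Real.exp_add, ← Real.exp_add, ← Real.exp_add]
    ring_nf
  rw [he]
  field_simp

end Comparison

theorem proposition3p1 {Ω : Type*} [MeasurableSpace Ω] (μ : Measure Ω) [IsProbabilityMeasure μ]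
    (σ : ℝ) (hσ0 : 0 < σ) (hσ1 : σ ≤ 1)
    -- `X ≥ 0` with `E[log (1 + X)] < ∞`, and an independent Bernoulli variable `Y = Y_σ`
    (X Y : Ω → ℝ) (hX : AEMeasurable X μ) (hX0 : 0 ≤ᵐ[μ] X)
    (hXlog : Integrable (fun ω => Real.log (1 + X ω)) μ)
    (hY : HasLaw Y (bernoulliMeasure (1 : ℝ) 0 ⟨σ, hσ0.le, hσ1⟩) μ)
    (hXY : IndepFun X Y μ)
    -- `F_{X Y_σ}` has no jump of size one
    (hjump : ∀ a : ℝ, (μ.map (fun ω => X ω * Y ω)).real {a} < 1)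
    -- the space that carries the Dirichlet processes
    {Ω' : Type*} [MeasurableSpace Ω'] (μ' : Measure Ω') [IsProbabilityMeasure μ'] :
    -- (i) both representations `M_1(F_{A_c Y_σ})` and `β_{σ,1-σ} M_σ(F_{A_c})`
    (∀ c : ℝ, 0 < c → ∀ ξ : ℝ → ℝ,
      ξ = (fun y : ℝ =>
        Real.exp (σ * levyExponent (μ.map X) c) * y ^ (σ - 1)
          / (Real.pi * c ^ σ * (1 - y) ^ σ)
          * Real.sin (Real.pi * cdf (μ.map (fun ω => X ω * Y ω)) (y / (c * (1 - y))))
          * Real.exp (-σ * logPotential (μ.map X) (y / (c * (1 - y))))) →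
      (∀ P : Ω' → Measure ℝ,
        IsDirichletProcess 1 (μ.map (fun ω => tiltVar c X ω * Y ω)) P μ' →
        (∀ᵐ ω ∂μ', Integrable (fun x : ℝ => x) (P ω)) ∧
        HasDensityOn (μ'.map (meanFunctional P)) (Set.Ioo 0 1) ξ) ∧
      (∀ (Q : Ω' → Measure ℝ) (B : Ω' → ℝ),
        IsDirichletProcess σ (μ.map (tiltVar c X)) Q μ' →
        HasLaw B (betaLaw σ (1 - σ)) μ' → IndepFun B (meanFunctional Q) μ' →
        (∀ᵐ ω ∂μ', Integrable (fun x : ℝ => x) (Q ω)) ∧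
        HasDensityOn (μ'.map (fun ω => B ω * meanFunctional Q ω)) (Set.Ioo 0 1) ξ)) ∧
    -- (ii) both representations `M_1(F_{X Y_σ})` and `β_{σ,1-σ} M_σ(F_X)`
    (∀ ξ : ℝ → ℝ,
      ξ = (fun x : ℝ =>
        Real.exp (-σ * levyExponent (μ.map X) 1) * x ^ (σ - 1)
          / (Real.pi * (1 + x) ^ σ)
          * Real.sin (Real.pi * cdf (μ.map (fun ω => tiltVar 1 X ω * Y ω)) (x / (1 + x)))
          * Real.exp (-σ * logPotential (μ.map (tiltVar 1 X)) (x / (1 + x)))) →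
      (∀ P : Ω' → Measure ℝ,
        IsDirichletProcess 1 (μ.map (fun ω => X ω * Y ω)) P μ' →
        (∀ᵐ ω ∂μ', Integrable (fun x : ℝ => x) (P ω)) ∧
        HasDensityOn (μ'.map (meanFunctional P)) (Set.Ioi 0) ξ) ∧
      (∀ (Q : Ω' → Measure ℝ) (B : Ω' → ℝ),
        IsDirichletProcess σ (μ.map X) Q μ' →
        HasLaw B (betaLaw σ (1 - σ)) μ' → IndepFun B (meanFunctional Q) μ' →
        (∀ᵐ ω ∂μ', Integrable (fun x : ℝ => x) (Q ω)) ∧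
        HasDensityOn (μ'.map (fun ω => B ω * meanFunctional Q ω)) (Set.Ioi 0) ξ)) := by
  have hσI : σ ∈ unitInterval := ⟨hσ0.le, hσ1⟩
  have hF : IsProbabilityMeasure (μ.map X) := Measure.isProbabilityMeasure_map hX
  have hF0 : ∀ᵐ x ∂μ.map X, 0 ≤ x := (ae_map_iff hX measurableSet_Ici).2 hX0
  have hFlog : Integrable (fun x => Real.log (1 + x)) (μ.map X) :=
    (integrable_map_measure
      (by fun_prop : Measurable fun x : ℝ => 1 + x).log.aestronglyMeasurable hX).2 hXlog
  have hG := isProbabilityMeasure_zeroInflated (F := μ.map X) hσ0.le hσ1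
  have hGeq : μ.map (fun ω => X ω * Y ω) = zeroInflated σ (μ.map X) :=
    map_mul_bernoulli hσI hX hY hXY
  have hG0 : ∀ᵐ x ∂zeroInflated σ (μ.map X), 0 ≤ x := ae_zeroInflated hF0 le_rfl measurableSet_Ici
  have hGlog : Integrable (fun x => Real.log (1 + x)) (zeroInflated σ (μ.map X)) :=
    integrable_zeroInflated (by fun_prop : Measurable fun x : ℝ => 1 + x).log hFlog
  have hatom : ∀ a, zeroInflated σ (μ.map X) {a} < 1 := fun a => by
    rw [← hGeq]
    have : IsProbabilityMeasure (μ.map fun ω => X ω * Y ω) := hGeq ▸ hG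
    exact (ENNReal.toReal_lt_toReal (measure_ne_top _ _) ENNReal.one_ne_top).1 (hjump a)
  have htilt : ∀ c : ℝ, μ.map (tiltVar c X) = (μ.map X).map (tiltMap c) := fun c =>
    (AEMeasurable.map_map_of_aemeasurable (measurable_tiltMap c).aemeasurable hX).symm
  have hGc : ∀ c : ℝ, μ.map (fun ω => tiltVar c X ω * Y ω)
      = zeroInflated σ ((μ.map X).map (tiltMap c)) := fun c => by
    rw [← htilt]
    exact map_mul_bernoulli hσI ((measurable_tiltMap c).comp_aemeasurable hX) hY
      (hXY.comp (measurable_tiltMap c) measurable_id)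
  refine ⟨fun c hc ξ hξ => ?_, fun ξ hξ => ?_⟩
  · have hm := measurable_tiltMap c
    have hFc := Measure.isProbabilityMeasure_map hm.aemeasurable (μ := μ.map X)
    have hFc0 := ae_map_tiltMap_nonneg hc hF0
    have hFclog := integrable_log_one_add_map_tiltMap hc hF0
    have hGcp := isProbabilityMeasure_zeroInflated (F := (μ.map X).map (tiltMap c)) hσ0.le hσ1
    have hGc0 : ∀ᵐ x ∂zeroInflated σ ((μ.map X).map (tiltMap c)), 0 ≤ x :=
      ae_zeroInflated hFc0 le_rfl measurableSet_Ici
    have hGc1 : ∀ᵐ x ∂zeroInflated σ ((μ.map X).map (tiltMap c)), x < 1 :=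
      ae_zeroInflated (ae_map_tiltMap_lt_one hc hF0) zero_lt_one measurableSet_Iio
    have hGclog : Integrable (fun x => Real.log (1 + x))
        (zeroInflated σ ((μ.map X).map (tiltMap c))) :=
      integrable_zeroInflated (by fun_prop : Measurable fun x : ℝ => 1 + x).log hFclog
    -- The tilt fixes 0, so it commutes with mixing in δ₀, and its injectivity on the half-line
    -- creates no unit atom.
    have hGcatom : ∀ a, zeroInflated σ ((μ.map X).map (tiltMap c)) {a} < 1 := by
      rw [← map_zeroInflated hm (tiltMap_zero c)]
      exact map_tiltMap_singleton_lt_one hc hG0 hatom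
    have hin : ∀ᵐ y : ℝ, y ∈ Set.Ioo (0 : ℝ) 1 →
        ξ y = cifarelliDensity (zeroInflated σ ((μ.map X).map (tiltMap c))) y := by
      rw [hξ, hGeq]
      exact ae_cifarelliDensity_map_tiltMap hσ0.le hσ1 hF0 hFlog hc
    have hout : ∀ᵐ y : ℝ, y ∉ Set.Ioo (0 : ℝ) 1 →
        cifarelliDensity (zeroInflated σ ((μ.map X).map (tiltMap c))) y = 0 := by
      filter_upwards [ae_ne_real 0] with y hy0 hy
      rcases lt_or_gt_of_ne hy0 with h | h
      · exact cifarelliDensity_of_neg hGc0 h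
      · exact cifarelliDensity_of_one_le hGc1 (not_lt.1 fun h1 => hy ⟨h, h1⟩)
    rw [hGc, htilt]
    exact ⟨fun P hP => ⟨hP.ae_integrable one_pos hGc0 hGclog,
        hasDensityOn_of_eq_withDensity measurableSet_Ioo
          (hP.map_meanFunctional hGc0 hGclog hGcatom) hin hout⟩,
      fun Q B hQ hB hind => ⟨hQ.ae_integrable hσ0 hFc0 hFclog,
        hasDensityOn_of_eq_withDensity measurableSet_Ioo
          (hQ.map_beta_mul_meanFunctional hσ0 hσ1 hFc0 hFclog hGcatom hB hind) hin hout⟩⟩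
  · have hin : ∀ᵐ x : ℝ, x ∈ Set.Ioi (0 : ℝ) →
        ξ x = cifarelliDensity (zeroInflated σ (μ.map X)) x := by
      rw [hξ, hGc, htilt]
      exact ae_cifarelliDensity_zeroInflated hσ0.le hσ1 hF0 hFlog
    have hout : ∀ᵐ x : ℝ, x ∉ Set.Ioi (0 : ℝ) →
        cifarelliDensity (zeroInflated σ (μ.map X)) x = 0 := by
      filter_upwards [ae_ne_real 0] with x hx0 hx
      exact cifarelliDensity_of_neg hG0 (lt_of_le_of_ne (not_lt.1 hx) hx0)
    rw [hGeq]
    exact ⟨fun P hP => ⟨hP.ae_integrable one_pos hG0 hGlog,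
        hasDensityOn_of_eq_withDensity measurableSet_Ioi
          (hP.map_meanFunctional hG0 hGlog hatom) hin hout⟩,
      fun Q B hQ hB hind => ⟨hQ.ae_integrable hσ0 hF0 hFlog,
        hasDensityOn_of_eq_withDensity measurableSet_Ioi
          (hQ.map_beta_mul_meanFunctional hσ0 hσ1 hF0 hFlog hatom hB hind) hin hout⟩⟩
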